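/- Let $V\in L^1_{\mathrm{loc}}(\mathbb R^3)$ be a complex-valued potential such that $$\|V\|_{H(\mathbb R^3)}:=\operatorname*{ess\,sup}_{x\in\mathbb R^3}|x|^2|V(x)|<\infty .$$ Let $H_V=\Delta^2\dotplus V$ be the operator in $L^2(\mathbb R^3)$ associated with the form $$h_V(\varphi,\psi)=\int_{\mathbb R^3}\overline{\Delta\varphi}\,\Delta\psi\,dx+\int_{\mathbb R^3}V\,\overline{\varphi}\,\psi\,dx,\qquad \operatorname{Dom}(h_V)=\Big\{\psi\in H^2(\mathbb R^3):\int_{\mathbb R^3}|V||\psi|^2\,dx<\infty\Big\}$$ (under the present hypothesis this domain is all of $H^2(\mathbb R^3)$); that is, $\psi\in\operatorname{Dom}(H_V)$ and $H_V\psi=f$ if and only if $\psi\in\operatorname{Dom}(h_V)$, $f\in L^2(\mathbb R^3)$ and $h_V(\varphi,\psi)=\int_{\mathbb R^3}\overline{\varphi}\,f\,dx$ for all $\varphi\in\operatorname{Dom}(h_V)$. Then every eigenvalue of $H_V$ (including those embedded in $[0,\infty)$) satisfies the bound below; in terms of the point spectrum, $$\sigma_{\mathrm p}(H_V)\subset\left\{\lambda\in\mathbb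 C:\ |\lambda|\le 16\,\|V\|_{H(\mathbb R^3)}^2\right\}.$$ -/

import Mathlib

open MeasureTheory
open scoped ENNReal SchwartzMap Laplacian InnerProductSpace

noncomputable section

/-- Three-dimensional Euclidean space. -/
abbrev R3 : Type := EuclideanSpace ℝ (Fin 3)

/-- The complex Hilbert space `L²(ℝ³)`. -/
abbrev L2R3 : Type := Lp ℂ 2 (volume : Measure R3)

/-! ### The Sobolev space `H²(ℝ³)` and the Laplacian on it -/

/-- The Sobolev space `H²(ℝ³)` as a subspace of `L²(ℝ³)`. -/
def sobolevH2 : Submodule ℂ L2R3 where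
  carrier := {u | TemperedDistribution.MemSobolev 2 2 (u : 𝓢'(R3, ℂ))}
  add_mem' := by
    intro u v hu hv
    have h := TemperedDistribution.MemSobolev.add hu hv
    rw [← Lp.toTemperedDistributionCLM_apply, ← Lp.toTemperedDistributionCLM_apply,
      ← map_add] at h
    exact h
  zero_mem' := by
    have h := TemperedDistribution.memSobolev_fun_zero R3 ℂ 2 2
    rw [← map_zero (Lp.toTemperedDistributionCLM ℂ (volume : Measure R3) 2)] at h
    exact h
  smul_mem' := by
    intro c u hu
    have h := TemperedDistribution.MemSobolev.smul c hu
    rw [← Lp.toTemperedDistributionCLM_apply, ← map_smul] at h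
    exact h

theorem toTemperedDistribution_injective {u v : L2R3}
    (h : (u : 𝓢'(R3, ℂ)) = (v : 𝓢'(R3, ℂ))) : u = v := by
  have hk := Lp.ker_toTemperedDistributionCLM_eq_bot (F := ℂ) (μ := (volume : Measure R3)) (p := 2)
  exact LinearMap.ker_eq_bot.mp hk h

theorem exists_laplacian_of_mem_sobolevH2 (u : sobolevH2) :
    ∃ g : L2R3, Δ ((u : L2R3) : 𝓢'(R3, ℂ)) = (g : 𝓢'(R3, ℂ)) := by
  have h := TemperedDistribution.MemSobolev.laplacian u.2
  rw [sub_self] at h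
  exact TemperedDistribution.memSobolev_zero_iff.mp h

/-- The `L²` function `Δu` that represents the distributional Laplacian of `u ∈ H²(ℝ³)`. -/
def laplacianFun (u : sobolevH2) : L2R3 :=
  (exists_laplacian_of_mem_sobolevH2 u).choose

theorem laplacianFun_spec (u : sobolevH2) :
    Δ ((u : L2R3) : 𝓢'(R3, ℂ)) = (laplacianFun u : 𝓢'(R3, ℂ)) :=
  (exists_laplacian_of_mem_sobolevH2 u).choose_spec

theorem laplacianFun_spec_clm (u : sobolevH2) :
    LineDeriv.laplacianCLM ℂ R3 𝓢'(R3, ℂ)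
        (Lp.toTemperedDistributionCLM ℂ (volume : Measure R3) 2 (u : L2R3)) =
      Lp.toTemperedDistributionCLM ℂ (volume : Measure R3) 2 (laplacianFun u) := by
  rw [TemperedDistribution.laplacianCLM_apply]
  exact laplacianFun_spec u

theorem laplacianFun_unique (u : sobolevH2) (g : L2R3)
    (h : LineDeriv.laplacianCLM ℂ R3 𝓢'(R3, ℂ)
        (Lp.toTemperedDistributionCLM ℂ (volume : Measure R3) 2 (u : L2R3)) =
      Lp.toTemperedDistributionCLM ℂ (volume : Measure R3) 2 g) : laplacianFun u = g := by
  apply toTemperedDistribution_injective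
  rw [laplacianFun_spec_clm] at h
  exact h

/-- The Laplacian as a linear map `Δ : H²(ℝ³) → L²(ℝ³)`. -/
def laplacianH2 : sobolevH2 →ₗ[ℂ] L2R3 where
  toFun := laplacianFun
  map_add' u v := by
    apply laplacianFun_unique
    rw [map_add, ← laplacianFun_spec_clm, ← laplacianFun_spec_clm, ← map_add, ← map_add,
      Submodule.coe_add]
  map_smul' c u := by
    apply laplacianFun_unique
    rw [RingHom.id_apply, map_smul, ← laplacianFun_spec_clm, ← map_smul, ← map_smul,
      Submodule.coe_smul]

/-! ### The quadratic form of `Δ² ∔ V` -/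

theorem aestronglyMeasurable_normV_sq {V : R3 → ℂ} (hV : LocallyIntegrable V volume) (ψ : L2R3) :
    AEStronglyMeasurable (fun x => ‖V x‖ * ‖ψ x‖ ^ 2) volume :=
  hV.aestronglyMeasurable.norm.mul ((Lp.aestronglyMeasurable ψ).norm.pow 2)

/-- The domain of the form `h_V`: all `ψ ∈ H²(ℝ³)` with `∫ |V| |ψ|² < ∞`. -/
def formDomain (V : R3 → ℂ) (hV : LocallyIntegrable V volume) : Submodule ℂ L2R3 where
  carrier := {ψ | ψ ∈ sobolevH2 ∧ Integrable (fun x => ‖V x‖ * ‖ψ x‖ ^ 2) volume}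
  add_mem' := by
    rintro u v ⟨hu, hu'⟩ ⟨hv, hv'⟩
    refine ⟨sobolevH2.add_mem hu hv, ?_⟩
    refine ((hu'.add hv').const_mul 2).mono (aestronglyMeasurable_normV_sq hV _) ?_
    filter_upwards [Lp.coeFn_add u v] with x hx
    rw [hx, Pi.add_apply, Pi.add_apply, Real.norm_of_nonneg (by positivity),
      Real.norm_of_nonneg (by positivity)]
    have h1 : ‖u x + v x‖ ^ 2 ≤ 2 * (‖u x‖ ^ 2 + ‖v x‖ ^ 2) := by
      have h2 := norm_add_le (u x) (v x)
      nlinarith [sq_nonneg (‖u x‖ - ‖v x‖), norm_nonneg (u x + v x)]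
    nlinarith [norm_nonneg (V x)]
  zero_mem' := by
    refine ⟨sobolevH2.zero_mem, ?_⟩
    refine (integrable_zero R3 ℝ volume).congr ?_
    filter_upwards [Lp.coeFn_zero ℂ 2 (volume : Measure R3)] with x hx
    rw [hx, Pi.zero_apply]
    simp
  smul_mem' := by
    rintro c u ⟨hu, hu'⟩
    refine ⟨sobolevH2.smul_mem c hu, ?_⟩
    refine (hu'.const_mul (‖c‖ ^ 2)).congr ?_
    filter_upwards [Lp.coeFn_smul c u] with x hx
    rw [hx, Pi.smul_apply, norm_smul]
    ring

/-- An element of the form domain, as an element of `H²(ℝ³)`. -/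
def formToH2 {V : R3 → ℂ} {hV : LocallyIntegrable V volume} :
    formDomain V hV →ₗ[ℂ] sobolevH2 :=
  Submodule.inclusion fun _ h => h.1

/-- The sesquilinear form
`h_V(φ, ψ) = ∫ conj (Δφ) Δψ + ∫ V conj φ ψ`, conjugate-linear in `φ`. -/
def biharmonicForm (V : R3 → ℂ) (hV : LocallyIntegrable V volume) (φ ψ : formDomain V hV) : ℂ :=
  (∫ x, starRingEnd ℂ (laplacianH2 (formToH2 φ) x) * laplacianH2 (formToH2 ψ) x) +
    ∫ x, V x * (starRingEnd ℂ ((φ : L2R3) x) * (ψ : L2R3) x)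

theorem integrable_potential_mul {V : R3 → ℂ} {hV : LocallyIntegrable V volume}
    (φ ψ : formDomain V hV) :
    Integrable (fun x => V x * (starRingEnd ℂ ((φ : L2R3) x) * (ψ : L2R3) x)) volume := by
  refine (φ.2.2.add ψ.2.2).mono ?_ ?_
  · exact hV.aestronglyMeasurable.mul
      ((Complex.continuous_conj.comp_aestronglyMeasurable (Lp.aestronglyMeasurable _)).mul
        (Lp.aestronglyMeasurable _))
  · filter_upwards with x
    rw [Pi.add_apply, Real.norm_of_nonneg (by positivity), norm_mul, norm_mul, RCLike.norm_conj,
      ← mul_add]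
    refine mul_le_mul_of_nonneg_left ?_ (norm_nonneg _)
    nlinarith [sq_nonneg (‖(φ : L2R3) x‖ - ‖(ψ : L2R3) x‖), sq_nonneg ‖(φ : L2R3) x‖,
      sq_nonneg ‖(ψ : L2R3) x‖]

theorem biharmonicForm_eq_inner (V : R3 → ℂ) (hV : LocallyIntegrable V volume)
    (φ ψ : formDomain V hV) :
    biharmonicForm V hV φ ψ = ⟪laplacianH2 (formToH2 φ), laplacianH2 (formToH2 ψ)⟫_ℂ +
      ∫ x, V x * (starRingEnd ℂ ((φ : L2R3) x) * (ψ : L2R3) x) := by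
  rw [biharmonicForm, L2.inner_def]
  congr 1
  apply integral_congr_ae
  filter_upwards with x
  rw [RCLike.inner_apply, mul_comm]

theorem biharmonicForm_add (V : R3 → ℂ) (hV : LocallyIntegrable V volume)
    (φ ψ₁ ψ₂ : formDomain V hV) :
    biharmonicForm V hV φ (ψ₁ + ψ₂) = biharmonicForm V hV φ ψ₁ + biharmonicForm V hV φ ψ₂ := by
  rw [biharmonicForm_eq_inner, biharmonicForm_eq_inner, biharmonicForm_eq_inner, map_add, map_add,
    inner_add_right, add_add_add_comm,
    ← integral_add (integrable_potential_mul φ ψ₁) (integrable_potential_mul φ ψ₂)]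
  congr 1
  apply integral_congr_ae
  filter_upwards [Lp.coeFn_add (ψ₁ : L2R3) (ψ₂ : L2R3)] with x hx
  rw [Submodule.coe_add, hx, Pi.add_apply]
  ring

theorem biharmonicForm_smul (V : R3 → ℂ) (hV : LocallyIntegrable V volume)
    (c : ℂ) (φ ψ : formDomain V hV) :
    biharmonicForm V hV φ (c • ψ) = c * biharmonicForm V hV φ ψ := by
  rw [biharmonicForm_eq_inner, biharmonicForm_eq_inner, map_smul, map_smul, inner_smul_right,
    mul_add, ← integral_const_mul]
  congr 1
  apply integral_congr_ae
  filter_upwards [Lp.coeFn_smul c (ψ : L2R3)] with x hx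
  rw [Submodule.coe_smul, hx, Pi.smul_apply, smul_eq_mul]
  ring

/-- Smooth compactly supported functions lie in the form domain, which is therefore dense. -/
theorem dense_formDomain (V : R3 → ℂ) (hV : LocallyIntegrable V volume) :
    Dense (formDomain V hV : Set L2R3) := by
  refine (Lp.dense_hasCompactSupport_contDiff (F := ℂ) (μ := (volume : Measure R3)) (p := 2)
    (by norm_num)).mono ?_
  rintro f ⟨g, hfg, hg, hg'⟩
  refine ⟨?_, ?_⟩
  · have h1 : f = (hg.toSchwartzMap hg').toLp 2 volume := by
      apply Lp.ext
      refine hfg.trans (Filter.EventuallyEq.trans ?_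
        ((hg.toSchwartzMap hg').coeFn_toLp 2 volume).symm)
      exact Filter.Eventually.of_forall fun x => rfl
    have h2 := SchwartzMap.memSobolev (s := 2) (p := 2) (hg.toSchwartzMap hg')
    rw [← Lp.toTemperedDistribution_toLp_eq (p := 2), ← h1] at h2
    exact h2
  · have hVn : LocallyIntegrable (fun x => ‖V x‖) volume := fun x => (hV x).norm
    have h1 : Integrable (fun x => (‖g x‖ ^ 2) • ‖V x‖) volume := by
      refine LocallyIntegrable.integrable_smul_left_of_hasCompactSupport hVn
        (by have := hg'.continuous; fun_prop) ?_
      exact hg.comp_left (g := fun z : ℂ => ‖z‖ ^ 2) (by simp)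
    refine h1.congr ?_
    filter_upwards [hfg] with x hx
    rw [hx, smul_eq_mul, mul_comm]

/-! ### The operator `H_V = Δ² ∔ V` -/

/-- The graph of the operator associated with `h_V` by the representation theorem: `(ψ, f)` belongs
to it when `ψ ∈ Dom h_V`, `f ∈ L²` and `h_V(φ, ψ) = (φ, f)` for every `φ ∈ Dom h_V`. -/
def biharmonicGraph (V : R3 → ℂ) (hV : LocallyIntegrable V volume) :
    Submodule ℂ (L2R3 × L2R3) where
  carrier := {p | ∃ ψ : formDomain V hV, (ψ : L2R3) = p.1 ∧
    ∀ φ : formDomain V hV, biharmonicForm V hV φ ψ = ⟪(φ : L2R3), p.2⟫_ℂ}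
  add_mem' := by
    rintro p q ⟨u, hu, hu'⟩ ⟨v, hv, hv'⟩
    refine ⟨u + v, by simp [hu, hv], fun φ => ?_⟩
    rw [biharmonicForm_add, hu', hv', Prod.snd_add, inner_add_right]
  zero_mem' := by
    refine ⟨0, rfl, fun φ => ?_⟩
    have h := biharmonicForm_smul V hV 0 φ 0
    rw [zero_smul, zero_mul] at h
    rw [h, Prod.snd_zero, inner_zero_right]
  smul_mem' := by
    rintro c p ⟨u, hu, hu'⟩
    refine ⟨c • u, by simp [hu], fun φ => ?_⟩
    rw [biharmonicForm_smul, hu', Prod.smul_snd, inner_smul_right]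

/-- The graph is single-valued, because the form domain is dense. -/
theorem biharmonicGraph_single_valued (V : R3 → ℂ) (hV : LocallyIntegrable V volume)
    (p : L2R3 × L2R3) (hp : p ∈ biharmonicGraph V hV) (h0 : p.1 = 0) : p.2 = 0 := by
  obtain ⟨ψ, hψ, h⟩ := hp
  have hz : ψ = (0 : ℂ) • (0 : formDomain V hV) := by
    apply Subtype.ext
    rw [hψ, h0]
    simp
  refine (dense_formDomain V hV).eq_zero_of_inner_right (𝕜 := ℂ) ?_
  intro φ hφ
  rw [← h ⟨φ, hφ⟩, hz, biharmonicForm_smul, zero_mul]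

/-- The biharmonic Schrödinger operator `H_V = Δ² ∔ V` in `L²(ℝ³)`, i.e. the (unbounded) operator
associated with the form `h_V`. -/
def biharmonicOperator (V : R3 → ℂ) (hV : LocallyIntegrable V volume) : L2R3 →ₗ.[ℂ] L2R3 :=
  (biharmonicGraph V hV).toLinearPMap

theorem biharmonicOperator_graph (V : R3 → ℂ) (hV : LocallyIntegrable V volume) :
    (biharmonicOperator V hV).graph = biharmonicGraph V hV :=
  Submodule.toLinearPMap_graph_eq _ (biharmonicGraph_single_valued V hV)

/-- The point spectrum (set of eigenvalues) of an unbounded operator in `L²(ℝ³)`. -/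
def pointSpectrum (T : L2R3 →ₗ.[ℂ] L2R3) : Set ℂ :=
  {μ | ∃ ψ : T.domain, (ψ : L2R3) ≠ 0 ∧ T ψ = μ • (ψ : L2R3)}

/-! ### Hardy-type potentials -/

/-- `‖V‖_H = ess sup |x|² |V(x)|`, as an extended non-negative number. -/
def hardyNorm (V : R3 → ℂ) : ℝ≥0∞ :=
  essSup (fun x => ‖x‖ₑ ^ 2 * ‖V x‖ₑ) volume

end

open Set Filter Topology FourierTransform

/-! ### The Newtonian potential of a power -/

/-! The proof is a Birman–Schwinger argument carried out pointwise, with a bound on the free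
resolvent that is uniform up to the real axis. For nonreal `z = s²`, partial fractions give `(Δ² -
z)⁻¹ = (2s)⁻¹ ((-Δ - s)⁻¹ - (-Δ + s)⁻¹)`. In dimension three both resolvents on the right have
Yukawa kernels, dominated by the Newtonian kernel `1/(4π|x|)`, so the kernel of `(Δ² - z)⁻¹` is at
most `|z|^(-1/2)` times the Newtonian one (`exists_bilaplacian_resolvent_kernel`). Nothing in this
bound deteriorates as `z` becomes real.

Let `ψ` be an eigenfunction for `μ ≠ 0`. Testing its equation against `(Δ² - z)⁻¹ η`, with `η`
Schwartz, expresses `∫ η ψ` through a term with the factor `μ - z` and a term with `V`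
(`integral_mul_eigenfunction_eq`). As `z → μ` nontangentially the first term vanishes, because the
symbol `|2πξ|⁴` takes the value `μ` only on a null set
(`tendsto_sub_mul_integral_bilaplacianResolvent`); this is why embedded eigenvalues need no separate
treatment. The kernel bound controls the second term, and mollifiers turn the result into the
pointwise estimate `|ψ| ≤ |μ|^(-1/2) (-Δ)⁻¹ |Vψ|` (`ae_enorm_le_of_forall_schwartz`).

Put `u = |V|^(1/2) |ψ|`, which is in `L²` by the form domain, and `A = ‖V‖_H`. Since `|V|^(1/2) ≤
A^(1/2) / |x|`, it follows that `u ≤ |μ|^(-1/2) A |x|⁻¹ (-Δ)⁻¹ |x|⁻¹ u`. The operator on the right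
has norm at most `4`, which is Hardy's inequality in dual form, proved here by a Schur test with
weight `|x|^(-3/2)` (`lintegral_weighted_newtonPotential_sq_le`). Hence `‖u‖² ≤ (16 A² / |μ|) ‖u‖²`,
so `|μ| > 16 A²` forces `u = 0`, and the pointwise estimate then gives `ψ = 0`. -/

theorem lintegral_rpow_mul_exp_neg {s r : ℝ} (hs : 0 < s) (hr : 0 < r) :
    ∫⁻ t in Ioi (0 : ℝ), ENNReal.ofReal (t ^ (s - 1) * Real.exp (-(r * t))) =
      ENNReal.ofReal (r ^ (-s) * Real.Gamma s) := by
  have h := Real.integral_rpow_mul_exp_neg_mul_Ioi hs hr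
  have hpos : 0 < (1 / r) ^ s * Real.Gamma s := by
    have := Real.Gamma_pos_of_pos hs
    positivity
  rw [← ofReal_integral_eq_lintegral_ofReal, h]
  · rw [one_div, Real.inv_rpow hr.le, Real.rpow_neg hr.le]
  · by_contra hn
    rw [integral_undef hn] at h
    exact hpos.ne h
  · filter_upwards [ae_restrict_mem measurableSet_Ioi] with t ht
    have : 0 < t := ht
    simp only [Pi.zero_apply]
    positivity

/-- Complete the square around `(a / (a + b)) • x` and translate. -/
theorem lintegral_gaussian_translate {a b : ℝ} (ha : 0 < a) (hb : 0 < b) (x : R3) :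
    ∫⁻ y : R3, ENNReal.ofReal (Real.exp (-(a * ‖x - y‖ ^ 2 + b * ‖y‖ ^ 2))) =
      ENNReal.ofReal ((Real.pi / (a + b)) ^ (3 / 2 : ℝ) *
        Real.exp (-(a * b / (a + b) * ‖x‖ ^ 2))) := by
  have hab : 0 < a + b := by positivity
  have h0 := GaussianFourier.integral_rexp_neg_mul_sq_norm (V := R3) hab
  have hpos : 0 < (Real.pi / (a + b)) ^ ((Module.finrank ℝ R3 : ℝ) / 2) := by
    have := Real.pi_pos
    positivity
  have h1 : ∫⁻ y : R3, ENNReal.ofReal (Real.exp (-(a + b) * ‖y‖ ^ 2)) =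
      ENNReal.ofReal ((Real.pi / (a + b)) ^ (3 / 2 : ℝ)) := by
    rw [← ofReal_integral_eq_lintegral_ofReal, h0]
    · simp
    · by_contra hn
      rw [integral_undef hn] at h0
      exact hpos.ne h0
    · exact Eventually.of_forall fun y => (Real.exp_pos _).le
  have h2 : ∀ y : R3, ENNReal.ofReal (Real.exp (-(a * ‖x - y‖ ^ 2 + b * ‖y‖ ^ 2))) =
      ENNReal.ofReal (Real.exp (-(a * b / (a + b) * ‖x‖ ^ 2))) *
        ENNReal.ofReal (Real.exp (-(a + b) * ‖y - (a / (a + b)) • x‖ ^ 2)) := by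
    intro y
    rw [← ENNReal.ofReal_mul (Real.exp_pos _).le, ← Real.exp_add, norm_sub_sq_real,
      norm_sub_sq_real, norm_smul, inner_smul_right, real_inner_comm y x, mul_pow,
      Real.norm_eq_abs, sq_abs]
    congr 2
    field_simp
    ring
  simp_rw [h2]
  rw [lintegral_const_mul' _ _ ENNReal.ofReal_ne_top,
    lintegral_sub_right_eq_self
      (fun y : R3 => ENNReal.ofReal (Real.exp (-(a + b) * ‖y‖ ^ 2))) ((a / (a + b)) • x),
    h1, ← ENNReal.ofReal_mul (Real.exp_pos _).le, mul_comm]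

theorem lintegral_rpow_mul_one_add_rpow :
    ∫⁻ t in Ioi (0 : ℝ), ENNReal.ofReal (t ^ (-3 / 4 : ℝ) * (1 + t) ^ (-5 / 4 : ℝ)) = 4 := by
  -- The integral is the Beta value `B(1/4, 1)`, for which an explicit antiderivative exists.
  set g : ℝ → ℝ := fun t => 4 * (t / (1 + t)) ^ (1 / 4 : ℝ) with hg
  have hpos : ∀ t ∈ Ioi (0 : ℝ), 0 ≤ t ^ (-3 / 4 : ℝ) * (1 + t) ^ (-5 / 4 : ℝ) := by
    intro t ht
    have : 0 < t := ht
    positivity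
  have hcont : ContinuousWithinAt g (Ici 0) 0 := by
    apply ContinuousAt.continuousWithinAt
    refine ContinuousAt.mul continuousAt_const ?_
    refine ContinuousAt.rpow_const ?_ (Or.inr (by norm_num))
    exact ContinuousAt.div continuousAt_id (by fun_prop) (by norm_num)
  have hderiv : ∀ t ∈ Ioi (0 : ℝ),
      HasDerivAt g (t ^ (-3 / 4 : ℝ) * (1 + t) ^ (-5 / 4 : ℝ)) t := by
    intro t ht
    have ht : 0 < t := ht
    have ht1 : 0 < 1 + t := by positivity
    have h1 : HasDerivAt (fun t : ℝ => t / (1 + t)) ((1 * (1 + t) - t * 1) / (1 + t) ^ 2) t :=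
      (hasDerivAt_id t).div ((hasDerivAt_id t).const_add 1) ht1.ne'
    have h2 := (h1.rpow_const (p := 1 / 4) (Or.inl (by positivity))).const_mul 4
    refine (show HasDerivAt g _ t from h2).congr_deriv (Eq.symm ?_)
    rw [Real.div_rpow ht.le ht1.le]
    have e1 : (1 + t) ^ (-5 / 4 : ℝ) = (1 + t) ^ (3 / 4 : ℝ) / (1 + t) ^ 2 := by
      rw [← Real.rpow_natCast, ← Real.rpow_sub ht1]
      norm_num
    have e2 : (1 + t) ^ (1 / 4 - 1 : ℝ) = ((1 + t) ^ (3 / 4 : ℝ))⁻¹ := by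
      rw [← Real.rpow_neg ht1.le]
      norm_num
    have e3 : (1 / 4 - 1 : ℝ) = -3 / 4 := by norm_num
    rw [e1, e2, e3]
    field_simp
    ring
  have hlim : Tendsto g atTop (𝓝 4) := by
    have h1 : Tendsto (fun t : ℝ => t / (1 + t)) atTop (𝓝 1) := by
      have h2 : Tendsto (fun t : ℝ => 1 - (1 + t)⁻¹) atTop (𝓝 (1 - 0)) :=
        tendsto_const_nhds.sub
          (tendsto_inv_atTop_zero.comp (tendsto_atTop_add_const_left _ _ tendsto_id))
      rw [sub_zero] at h2
      refine h2.congr' ?_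
      filter_upwards [eventually_gt_atTop 0] with t ht
      field_simp
      ring
    have h3 := (h1.rpow_const (p := 1 / 4) (Or.inl one_ne_zero)).const_mul 4
    rw [Real.one_rpow, mul_one] at h3
    exact h3
  rw [← ofReal_integral_eq_lintegral_ofReal
    (integrableOn_Ioi_deriv_of_nonneg hcont hderiv hpos hlim)
    ((ae_restrict_mem measurableSet_Ioi).mono hpos),
    integral_Ioi_of_hasDerivAt_of_nonneg hcont hderiv hpos hlim]
  simp [hg]

/-- Equivalent to `-Δ |x|^(-1/2) = (1/4) |x|^(-5/2)`. Instead of inverting the Laplacian, both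
powers are written as Gamma integrals of Gaussians, after which Tonelli reduces everything to
explicit integrals. -/
theorem lintegral_inv_norm_sub_mul_rpow {x : R3} (hx : x ≠ 0) :
    ∫⁻ y : R3, ENNReal.ofReal (‖x - y‖⁻¹ * ‖y‖ ^ (-5 / 2 : ℝ)) =
      ENNReal.ofReal (16 * Real.pi * ‖x‖ ^ (-1 / 2 : ℝ)) := by
  -- With Gaussian parameters `a` for `|x - y|²` and `b` for `|y|²`, the weight is `a^(-1/2)
  -- b^(1/4)`. Substituting `a = b t` produces `b^(3/4) t^(-1/2)` and lets the `b` and `t` integrals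
  -- be evaluated one after the other.
  set F : ℝ → ℝ → R3 → ℝ≥0∞ := fun b t y => ENNReal.ofReal
    (b ^ (3 / 4 : ℝ) * t ^ (-1 / 2 : ℝ) * Real.exp (-(b * t * ‖x - y‖ ^ 2 + b * ‖y‖ ^ 2))) with hF
  have hxn : 0 < ‖x‖ := norm_pos_iff.mpr hx
  have hpi := Real.pi_pos
  set c : ℝ := Real.Gamma (1 / 2) * Real.Gamma (5 / 4) with hc
  have hG1 : 0 < Real.Gamma (1 / 2) := Real.Gamma_pos_of_pos (by norm_num)
  have hG2 : 0 < Real.Gamma (5 / 4) := Real.Gamma_pos_of_pos (by norm_num)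
  have hcpos : 0 < c := mul_pos hG1 hG2
  have hleft : ∀ᵐ y : R3, ∫⁻ b in Ioi (0 : ℝ), ∫⁻ t in Ioi (0 : ℝ), F b t y =
      ENNReal.ofReal c * ENNReal.ofReal (‖x - y‖⁻¹ * ‖y‖ ^ (-5 / 2 : ℝ)) := by
    filter_upwards [compl_mem_ae_iff.mpr (measure_singleton (μ := (volume : Measure R3)) x),
      compl_mem_ae_iff.mpr (measure_singleton (μ := (volume : Measure R3)) 0)] with y hy1 hy0
    have h1 : 0 < ‖x - y‖ := norm_pos_iff.mpr (sub_ne_zero.mpr fun h => hy1 h.symm)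
    have h0 : 0 < ‖y‖ := norm_pos_iff.mpr hy0
    have inner : ∀ b ∈ Ioi (0 : ℝ), ∫⁻ t in Ioi (0 : ℝ), F b t y =
        ENNReal.ofReal (Real.Gamma (1 / 2) * ‖x - y‖⁻¹) *
          ENNReal.ofReal (b ^ ((5 / 4 : ℝ) - 1) * Real.exp (-(‖y‖ ^ 2 * b))) := by
      intro b hb
      have hb : 0 < b := hb
      have e : ∀ t, F b t y = ENNReal.ofReal (b ^ (3 / 4 : ℝ) * Real.exp (-(‖y‖ ^ 2 * b))) *
          ENNReal.ofReal (t ^ ((1 / 2 : ℝ) - 1) * Real.exp (-((b * ‖x - y‖ ^ 2) * t))) := by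
        intro t
        rw [hF, ← ENNReal.ofReal_mul (by positivity)]
        have : -(b * t * ‖x - y‖ ^ 2 + b * ‖y‖ ^ 2) =
          -(‖y‖ ^ 2 * b) + -((b * ‖x - y‖ ^ 2) * t) := by ring
        simp only []
        rw [this, Real.exp_add]
        norm_num
        ring_nf
      simp_rw [e]
      rw [lintegral_const_mul' _ _ ENNReal.ofReal_ne_top,
        lintegral_rpow_mul_exp_neg (by norm_num) (by positivity),
        ← ENNReal.ofReal_mul (by positivity), ← ENNReal.ofReal_mul (by positivity),
        Real.mul_rpow hb.le (by positivity), ← Real.rpow_natCast ‖x - y‖ 2, ← Real.rpow_mul h1.le]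
      congr 1
      have e1 : b ^ ((5 / 4 : ℝ) - 1) = b ^ (3 / 4 : ℝ) * b ^ (-(1 / 2) : ℝ) := by
        rw [← Real.rpow_add hb]; norm_num
      have e2 : ‖x - y‖ ^ (((2 : ℕ) : ℝ) * -(1 / 2)) = ‖x - y‖⁻¹ := by
        rw [← Real.rpow_neg_one]; norm_num
      rw [e1, e2]
      ring
    rw [setLIntegral_congr_fun measurableSet_Ioi inner,
      lintegral_const_mul' _ _ ENNReal.ofReal_ne_top,
      lintegral_rpow_mul_exp_neg (by norm_num) (by positivity),
      ← ENNReal.ofReal_mul (by positivity), ← ENNReal.ofReal_mul (by positivity),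
      ← Real.rpow_natCast, ← Real.rpow_mul h0.le]
    congr 1
    have e2 : ‖y‖ ^ (((2 : ℕ) : ℝ) * -(5 / 4)) = ‖y‖ ^ (-5 / 2 : ℝ) := by norm_num
    rw [e2, hc]
    ring
  have hmeas : Measurable fun p : (ℝ × ℝ) × R3 => F p.1.1 p.1.2 p.2 := by
    rw [hF]
    fun_prop
  have hright : ∀ b ∈ Ioi (0 : ℝ), ∀ t ∈ Ioi (0 : ℝ), ∫⁻ y : R3, F b t y =
      ENNReal.ofReal (Real.pi ^ (3 / 2 : ℝ) * t ^ (-1 / 2 : ℝ) * (1 + t) ^ (-3 / 2 : ℝ)) *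
        ENNReal.ofReal (b ^ ((1 / 4 : ℝ) - 1) * Real.exp (-((t / (1 + t) * ‖x‖ ^ 2) * b))) := by
    intro b hb t ht
    have hb : 0 < b := hb
    have ht : 0 < t := ht
    simp_rw [hF, ENNReal.ofReal_mul (show 0 ≤ b ^ (3 / 4 : ℝ) * t ^ (-1 / 2 : ℝ) by positivity)]
    rw [lintegral_const_mul' _ _ ENNReal.ofReal_ne_top,
      lintegral_gaussian_translate (by positivity) hb, ← ENNReal.ofReal_mul (by positivity),
      ← ENNReal.ofReal_mul (by positivity)]
    congr 1
    have e1 : b * t + b = b * (1 + t) := by ring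
    have e2 : b * t * b / (b * (1 + t)) * ‖x‖ ^ 2 = t / (1 + t) * ‖x‖ ^ 2 * b := by
      field_simp
    have e3 : b ^ ((1 / 4 : ℝ) - 1) = b ^ (3 / 4 : ℝ) / b ^ (3 / 2 : ℝ) := by
      rw [← Real.rpow_sub hb]; norm_num
    have e4 : (1 + t) ^ (-3 / 2 : ℝ) = ((1 + t) ^ (3 / 2 : ℝ))⁻¹ := by
      rw [← Real.rpow_neg (by positivity)]; norm_num
    rw [e1, e2, e3, e4, Real.div_rpow hpi.le (by positivity), Real.mul_rpow hb.le (by positivity)]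
    field_simp
  have hbint : ∀ t ∈ Ioi (0 : ℝ), ∫⁻ b in Ioi (0 : ℝ), ∫⁻ y : R3, F b t y =
      ENNReal.ofReal (Real.pi ^ (3 / 2 : ℝ) * Real.Gamma (1 / 4) * ‖x‖ ^ (-1 / 2 : ℝ)) *
        ENNReal.ofReal (t ^ (-3 / 4 : ℝ) * (1 + t) ^ (-5 / 4 : ℝ)) := by
    intro t ht
    rw [setLIntegral_congr_fun measurableSet_Ioi fun b hb => hright b hb t ht]
    have ht : 0 < t := ht
    have ht1 : 0 < 1 + t := by positivity
    have hG := Real.Gamma_pos_of_pos (show (0 : ℝ) < 1 / 4 by norm_num)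
    rw [lintegral_const_mul' _ _ ENNReal.ofReal_ne_top,
      lintegral_rpow_mul_exp_neg (by norm_num) (by positivity),
      ← ENNReal.ofReal_mul (by positivity), ← ENNReal.ofReal_mul (by positivity),
      Real.mul_rpow (by positivity) (by positivity), Real.div_rpow ht.le ht1.le,
      ← Real.rpow_natCast, ← Real.rpow_mul hxn.le]
    congr 1
    have e1 : t ^ (-3 / 4 : ℝ) = t ^ (-1 / 2 : ℝ) * t ^ (-(1 / 4) : ℝ) := by
      rw [← Real.rpow_add ht]; norm_num
    have e2 : (1 + t) ^ (-5 / 4 : ℝ) = (1 + t) ^ (-3 / 2 : ℝ) / (1 + t) ^ (-(1 / 4) : ℝ) := by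
      rw [← Real.rpow_sub ht1]; norm_num
    have e3 : ‖x‖ ^ (((2 : ℕ) : ℝ) * -(1 / 4)) = ‖x‖ ^ (-1 / 2 : ℝ) := by norm_num
    rw [e1, e2, e3]
    ring
  have key : ENNReal.ofReal c * ∫⁻ y : R3, ENNReal.ofReal (‖x - y‖⁻¹ * ‖y‖ ^ (-5 / 2 : ℝ)) =
      ENNReal.ofReal c * ENNReal.ofReal (16 * Real.pi * ‖x‖ ^ (-1 / 2 : ℝ)) := by
    rw [← lintegral_const_mul' _ _ ENNReal.ofReal_ne_top, ← lintegral_congr_ae hleft,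
      lintegral_lintegral_swap (by
        apply Measurable.aemeasurable
        exact Measurable.lintegral_prod_right'
          (f := fun p : (R3 × ℝ) × ℝ => F p.1.2 p.2 p.1.1)
          (hmeas.comp (by fun_prop : Measurable fun p : (R3 × ℝ) × ℝ => ((p.1.2, p.2), p.1.1))))]
    have s1 : ∀ b, ∫⁻ y : R3, ∫⁻ t in Ioi (0 : ℝ), F b t y =
        ∫⁻ t in Ioi (0 : ℝ), ∫⁻ y : R3, F b t y := fun b =>
      lintegral_lintegral_swap (by
        apply Measurable.aemeasurable
        exact hmeas.comp (by fun_prop : Measurable fun p : R3 × ℝ => ((b, p.2), p.1)))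
    simp_rw [s1]
    rw [lintegral_lintegral_swap (by
        apply Measurable.aemeasurable
        exact Measurable.lintegral_prod_right'
          (f := fun p : (ℝ × ℝ) × R3 => F p.1.1 p.1.2 p.2) hmeas),
      setLIntegral_congr_fun measurableSet_Ioi hbint,
      lintegral_const_mul' _ _ ENNReal.ofReal_ne_top, lintegral_rpow_mul_one_add_rpow,
      ← ENNReal.ofReal_mul hcpos.le]
    rw [show (4 : ℝ≥0∞) = ENNReal.ofReal 4 by norm_num, ← ENNReal.ofReal_mul' (by norm_num)]
    congr 1
    have hG54 : Real.Gamma (5 / 4) = 1 / 4 * Real.Gamma (1 / 4) := by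
      rw [← Real.Gamma_add_one (by norm_num)]; norm_num
    have hpi32 : Real.pi ^ (3 / 2 : ℝ) = Real.pi * Real.sqrt Real.pi := by
      rw [Real.sqrt_eq_rpow, ← Real.rpow_one_add' hpi.le (by norm_num)]; norm_num
    rw [hc, hG54, Real.Gamma_one_half_eq, hpi32]
    ring
  exact (ENNReal.mul_right_inj (by simpa using hcpos) ENNReal.ofReal_ne_top).mp key

/-! ### The Schur test and the weighted Newtonian potential -/

/-- Cauchy–Schwarz applied to `k u = (k p)^(1/2) (k u² / p)^(1/2)` uses the weight inequality once;
after Tonelli, the symmetry of `k` lets it be used again. Each use costs one factor `C`. -/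
theorem lintegral_sq_le_of_schur {α : Type*} [MeasurableSpace α] {μ : Measure α} [SFinite μ]
    {k : α → α → ℝ≥0∞} (hk : Measurable (Function.uncurry k)) (hsymm : ∀ x y, k x y = k y x)
    {p : α → ℝ≥0∞} (hp : Measurable p) (hp0 : ∀ᵐ x ∂μ, p x ≠ 0 ∧ p x ≠ ∞) {C : ℝ≥0∞}
    (hC : ∀ᵐ x ∂μ, ∫⁻ y, k x y * p y ∂μ ≤ C * p x) {u : α → ℝ≥0∞} (hu : Measurable u) :
    ∫⁻ x, (∫⁻ y, k x y * u y ∂μ) ^ 2 ∂μ ≤ C ^ 2 * ∫⁻ x, u x ^ 2 ∂μ := by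
  have hkx : ∀ x, Measurable (k x) := fun x => hk.comp measurable_prodMk_left
  have hkp : ∀ x, Measurable fun y => k x y * p y := fun x => (hkx x).mul hp
  have hup : Measurable fun y => u y ^ 2 / p y := (hu.pow_const 2).div hp
  have hkup : ∀ x, Measurable fun y => k x y * (u y ^ 2 / p y) := fun x => (hkx x).mul hup
  have cauchy : ∀ x, (∫⁻ y, k x y * u y ∂μ) ^ 2 ≤
      (∫⁻ y, k x y * p y ∂μ) * ∫⁻ y, k x y * (u y ^ 2 / p y) ∂μ := by
    intro x
    have h1 : ∫⁻ y, k x y * u y ∂μ = ∫⁻ y, ((fun y => (k x y * p y) ^ (1 / 2 : ℝ)) *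
        fun y => (k x y * (u y ^ 2 / p y)) ^ (1 / 2 : ℝ)) y ∂μ := by
      apply lintegral_congr_ae
      filter_upwards [hp0] with y hy
      rw [Pi.mul_apply, ← ENNReal.mul_rpow_of_nonneg _ _ (by norm_num)]
      have : k x y * p y * (k x y * (u y ^ 2 / p y)) = (k x y * u y) ^ (2 : ℝ) := by
        rw [ENNReal.rpow_ofNat]
        calc k x y * p y * (k x y * (u y ^ 2 / p y))
            = k x y * k x y * (p y * (u y ^ 2 / p y)) := by ring
          _ = (k x y * u y) ^ 2 := by rw [ENNReal.mul_div_cancel hy.1 hy.2]; ring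
      rw [this, ← ENNReal.rpow_mul]
      norm_num
    have h2 := ENNReal.lintegral_mul_le_Lp_mul_Lq μ (p := 2) (q := 2)
      (Real.HolderConjugate.two_two)
      (f := fun y => (k x y * p y) ^ (1 / 2 : ℝ))
      (g := fun y => (k x y * (u y ^ 2 / p y)) ^ (1 / 2 : ℝ))
      ((hkp x).pow_const _).aemeasurable
      ((hkup x).pow_const _).aemeasurable
    simp_rw [← ENNReal.rpow_mul] at h2
    norm_num at h2
    rw [h1]
    refine (pow_le_pow_left' h2 2).trans (le_of_eq ?_)
    rw [mul_pow, ← ENNReal.rpow_ofNat, ← ENNReal.rpow_ofNat, ← ENNReal.rpow_mul,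
      ← ENNReal.rpow_mul]
    norm_num
  calc ∫⁻ x, (∫⁻ y, k x y * u y ∂μ) ^ 2 ∂μ
      ≤ ∫⁻ x, ∫⁻ y, C * p x * (k x y * (u y ^ 2 / p y)) ∂μ ∂μ := by
        apply lintegral_mono_ae
        filter_upwards [hC] with x hx
        rw [lintegral_const_mul _ (hkup x)]
        exact (cauchy x).trans (mul_le_mul_left hx _)
    _ = ∫⁻ y, ∫⁻ x, C * p x * (k x y * (u y ^ 2 / p y)) ∂μ ∂μ := by
        apply lintegral_lintegral_swap
        apply Measurable.aemeasurable
        exact ((hp.comp measurable_fst).const_mul C).mul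
          (hk.mul (hup.comp measurable_snd))
    _ ≤ ∫⁻ y, C ^ 2 * u y ^ 2 ∂μ := by
        apply lintegral_mono_ae
        filter_upwards [hC, hp0] with y hy hy0
        have : ∀ x, C * p x * (k x y * (u y ^ 2 / p y)) =
            C * (u y ^ 2 / p y) * (k y x * p x) := fun x => by rw [hsymm x y]; ring
        simp_rw [this]
        rw [lintegral_const_mul _ (hkp y)]
        refine (mul_le_mul_right hy _).trans (le_of_eq ?_)
        calc C * (u y ^ 2 / p y) * (C * p y) = C ^ 2 * (p y * (u y ^ 2 / p y)) := by ring
          _ = C ^ 2 * u y ^ 2 := by rw [ENNReal.mul_div_cancel hy0.1 hy0.2]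
    _ = C ^ 2 * ∫⁻ x, u x ^ 2 ∂μ := lintegral_const_mul _ (hu.pow_const 2)

/-- The Newtonian potential `∫ h(y) / (4π|x - y|) dy` of a nonnegative function. -/
noncomputable def newtonPotential (h : R3 → ℝ≥0∞) (x : R3) : ℝ≥0∞ :=
  ∫⁻ y, ENNReal.ofReal (4 * Real.pi * ‖x - y‖)⁻¹ * h y

theorem measurable_newtonPotential {h : R3 → ℝ≥0∞} (hh : Measurable h) :
    Measurable (newtonPotential h) := by
  refine Measurable.lintegral_prod_right'
    (f := fun p : R3 × R3 => ENNReal.ofReal (4 * Real.pi * ‖p.1 - p.2‖)⁻¹ * h p.2) ?_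
  fun_prop

theorem newtonPotential_congr {h h' : R3 → ℝ≥0∞} (hh : h =ᵐ[volume] h') :
    newtonPotential h = newtonPotential h' := by
  ext x
  apply lintegral_congr_ae
  filter_upwards [hh] with y hy
  rw [hy]

theorem newtonPotential_mono {h h' : R3 → ℝ≥0∞} (hh : h ≤ᵐ[volume] h') (x : R3) :
    newtonPotential h x ≤ newtonPotential h' x := by
  apply lintegral_mono_ae
  filter_upwards [hh] with y hy
  gcongr

theorem newtonPotential_const_mul {h : R3 → ℝ≥0∞} {c : ℝ≥0∞} (hc : c ≠ ∞) (x : R3) :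
    newtonPotential (fun y => c * h y) x = c * newtonPotential h x := by
  rw [newtonPotential, newtonPotential, ← lintegral_const_mul' _ _ hc]
  congr 1 with y
  ring

/-- `|x|⁻¹ (-Δ)⁻¹ |x|⁻¹` has norm at most `4` on `L²(ℝ³)`. -/
theorem lintegral_weighted_newtonPotential_sq_le {u : R3 → ℝ≥0∞} (hu : Measurable u) :
    ∫⁻ x, (ENNReal.ofReal ‖x‖⁻¹ * newtonPotential (fun y => ENNReal.ofReal ‖y‖⁻¹ * u y) x) ^ 2 ≤
      16 * ∫⁻ x, u x ^ 2 := by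
  have hne : ∀ᵐ x : R3, x ≠ 0 :=
    compl_mem_ae_iff.mpr (measure_singleton (μ := (volume : Measure R3)) 0)
  have h := lintegral_sq_le_of_schur (μ := (volume : Measure R3))
    (k := fun x y => ENNReal.ofReal
      (‖x‖⁻¹ * (4 * Real.pi * ‖x - y‖)⁻¹ * ‖y‖⁻¹))
    (by unfold Function.uncurry; fun_prop)
    (fun x y => by rw [norm_sub_rev]; congr 1; ring)
    -- Multiplied by `|y|⁻¹` this weight becomes `|y|^(-5/2)`, whose Newtonian potential is `4
    -- |x|^(-1/2)`; the outer `|x|⁻¹` restores the weight, with constant exactly `4`.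
    (p := fun x => ENNReal.ofReal (‖x‖ ^ (-3 / 2 : ℝ))) (by fun_prop)
    (by
      filter_upwards [hne] with x hx
      have := norm_pos_iff.mpr hx
      exact ⟨by simp only [ne_eq, ENNReal.ofReal_eq_zero, not_le]; positivity,
        ENNReal.ofReal_ne_top⟩)
    (C := 4)
    (by
      filter_upwards [hne] with x hx
      have hx0 := norm_pos_iff.mpr hx
      have hpi := Real.pi_pos
      have h1 : ∀ᵐ y : R3, ENNReal.ofReal (‖x‖⁻¹ * (4 * Real.pi * ‖x - y‖)⁻¹ * ‖y‖⁻¹) *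
          ENNReal.ofReal (‖y‖ ^ (-3 / 2 : ℝ)) = ENNReal.ofReal ((4 * Real.pi * ‖x‖)⁻¹) *
            ENNReal.ofReal (‖x - y‖⁻¹ * ‖y‖ ^ (-5 / 2 : ℝ)) := by
        filter_upwards [hne] with y hy
        have hy0 := norm_pos_iff.mpr hy
        rw [← ENNReal.ofReal_mul (by positivity), ← ENNReal.ofReal_mul (by positivity)]
        congr 1
        have : ‖y‖ ^ (-5 / 2 : ℝ) = ‖y‖⁻¹ * ‖y‖ ^ (-3 / 2 : ℝ) := by
          rw [← Real.rpow_neg_one, ← Real.rpow_add hy0]; norm_num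
        rw [this, mul_inv, mul_inv, mul_inv, mul_inv]
        ring
      rw [lintegral_congr_ae h1, lintegral_const_mul' _ _ ENNReal.ofReal_ne_top,
        lintegral_inv_norm_sub_mul_rpow hx, ← ENNReal.ofReal_mul (by positivity),
        show (4 : ℝ≥0∞) = ENNReal.ofReal 4 by norm_num, ← ENNReal.ofReal_mul (by norm_num)]
      apply le_of_eq
      congr 1
      have : ‖x‖ ^ (-3 / 2 : ℝ) = ‖x‖⁻¹ * ‖x‖ ^ (-1 / 2 : ℝ) := by
        rw [← Real.rpow_neg_one, ← Real.rpow_add hx0]; norm_num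
      rw [this]
      field_simp
      norm_num)
    hu
  have e : ∀ x, ENNReal.ofReal ‖x‖⁻¹ * newtonPotential (fun y => ENNReal.ofReal ‖y‖⁻¹ * u y) x =
      ∫⁻ y, ENNReal.ofReal (‖x‖⁻¹ * (4 * Real.pi * ‖x - y‖)⁻¹ * ‖y‖⁻¹) * u y := by
    intro x
    have hpi := Real.pi_pos
    rw [newtonPotential, ← lintegral_const_mul' _ _ ENNReal.ofReal_ne_top]
    congr 1 with y
    rw [ENNReal.ofReal_mul (by positivity), ENNReal.ofReal_mul (by positivity)]
    ring
  simp_rw [e]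
  rwa [show (4 : ℝ≥0∞) ^ 2 = 16 by norm_num] at h

/-! ### The Fourier transform of the Yukawa kernel -/

/-- Orthonormal coordinates of `ℝ³` as `ℝ × (ℝ × ℝ)`, the first axis being parallel to `ξ`. -/
theorem exists_coordinates_along (ξ : R3) :
    ∃ Ψ : R3 ≃ᵐ ℝ × (ℝ × ℝ), MeasurePreserving Ψ volume volume ∧
      (∀ x, ⟪x, ξ⟫_ℝ = (Ψ x).1 * ‖ξ‖) ∧
      ∀ x, ‖x‖ = √((Ψ x).1 ^ 2 + ((Ψ x).2.1 ^ 2 + (Ψ x).2.2 ^ 2)) := by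
  obtain ⟨b, hb⟩ : ∃ b : OrthonormalBasis (Fin 3) ℝ R3, ξ = ‖ξ‖ • b 0 := by
    by_cases hξ : ξ = 0
    · exact ⟨EuclideanSpace.basisFun (Fin 3) ℝ, by simp [hξ]⟩
    · have hv : Orthonormal ℝ (({0} : Set (Fin 3)).domRestrict fun _ => ‖ξ‖⁻¹ • ξ) := by
        refine ⟨fun i => norm_smul_inv_norm (𝕜 := ℝ) hξ, fun i j hij => ?_⟩
        exact absurd (Subsingleton.elim i j) hij
      obtain ⟨b, hb⟩ := hv.exists_orthonormalBasis_extension_of_card_eq (by simp)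
      refine ⟨b, ?_⟩
      rw [hb 0 rfl, smul_smul, mul_inv_cancel₀ (norm_ne_zero_iff.mpr hξ), one_smul]
  let e₁ : R3 ≃ᵐ EuclideanSpace ℝ (Fin 3) := b.repr.toHomeomorph.toMeasurableEquiv
  let e₂ : EuclideanSpace ℝ (Fin 3) ≃ᵐ (Fin 3 → ℝ) := (MeasurableEquiv.toLp 2 (Fin 3 → ℝ)).symm
  let e₃ : (Fin 3 → ℝ) ≃ᵐ ℝ × (Fin 2 → ℝ) := MeasurableEquiv.piFinSuccAbove (fun _ => ℝ) 0
  let e₄ : ℝ × (Fin 2 → ℝ) ≃ᵐ ℝ × (ℝ × ℝ) :=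
    (MeasurableEquiv.refl ℝ).prodCongr MeasurableEquiv.finTwoArrow
  have h₁ : MeasurePreserving e₁ volume volume := b.measurePreserving_repr
  have h₂ : MeasurePreserving e₂ volume volume :=
    EuclideanSpace.volume_preserving_symm_measurableEquiv_toLp (Fin 3)
  have h₃ : MeasurePreserving e₃ volume volume := volume_preserving_piFinSuccAbove (fun _ => ℝ) 0
  have h₄ : MeasurePreserving e₄ volume volume :=
    (MeasurePreserving.id volume).prod (volume_preserving_finTwoArrow ℝ)
  have hΨ : ∀ x, (((e₁.trans e₂).trans e₃).trans e₄) x =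
      (b.repr x 0, (b.repr x 1, b.repr x 2)) := fun x => rfl
  refine ⟨((e₁.trans e₂).trans e₃).trans e₄, h₄.comp (h₃.comp (h₂.comp h₁)), ?_, ?_⟩
  · intro x
    rw [hΨ]
    simp only
    rw [b.repr_apply_apply]
    nth_rw 1 [hb]
    rw [inner_smul_right, real_inner_comm, mul_comm]
  · intro x
    rw [hΨ, ← b.repr.norm_map x, EuclideanSpace.norm_eq, Fin.sum_univ_three]
    simp only [Real.norm_eq_abs, sq_abs, add_assoc]

/-- The Yukawa kernel, the fundamental solution of `-Δ + κ²` when `0 < re κ`. -/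
noncomputable def yukawa (κ : ℂ) (x : R3) : ℂ :=
  Complex.exp (-κ * ‖x‖) / (4 * Real.pi * ‖x‖)

theorem norm_yukawa (κ : ℂ) (x : R3) :
    ‖yukawa κ x‖ = Real.exp (-κ.re * ‖x‖) * (4 * Real.pi * ‖x‖)⁻¹ := by
  have hpi := Real.pi_pos
  rw [yukawa, norm_div, Complex.norm_exp, div_eq_mul_inv]
  congr 2
  · simp
  · rw [norm_mul, norm_mul, Complex.norm_real, Complex.norm_real, norm_norm,
      Real.norm_of_nonneg hpi.le]
    simp

theorem norm_yukawa_le {κ : ℂ} (hκ : 0 < κ.re) (x : R3) :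
    ‖yukawa κ x‖ ≤ (4 * Real.pi * ‖x‖)⁻¹ := by
  have hpi := Real.pi_pos
  rw [norm_yukawa]
  refine mul_le_of_le_one_left (by positivity) (Real.exp_le_one_iff.mpr ?_)
  have := mul_nonneg hκ.le (norm_nonneg x)
  linarith

theorem measurable_yukawa (κ : ℂ) : Measurable (yukawa κ) := by
  unfold yukawa
  fun_prop

theorem integrable_yukawa {κ : ℂ} (hκ : 0 < κ.re) : Integrable (yukawa κ) := by
  have hpi := Real.pi_pos
  have h : Integrable fun x : R3 => Real.exp (-κ.re * ‖x‖) * (4 * Real.pi * ‖x‖)⁻¹ := by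
    rw [integrable_fun_norm_addHaar (volume : Measure R3)
      (f := fun r => Real.exp (-κ.re * r) * (4 * Real.pi * r)⁻¹)]
    have h1 := (integrableOn_rpow_mul_exp_neg_mul_rpow (p := 1) (s := 1) (b := κ.re)
      (by norm_num) one_pos hκ).const_mul (4 * Real.pi)⁻¹
    refine IntegrableOn.congr_fun h1 ?_ measurableSet_Ioi
    intro r hr
    have hr : 0 < r := hr
    simp only [Real.rpow_one, finrank_euclideanSpace, Fintype.card_fin, smul_eq_mul]
    field_simp
  refine h.mono (measurable_yukawa κ).aestronglyMeasurable (Eventually.of_forall fun x => ?_)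
  rw [← norm_yukawa, norm_norm]

theorem hasDerivAt_sqrt_add_sq {s : ℝ} (hs : s ≠ 0) (r : ℝ) :
    HasDerivAt (fun r : ℝ => √(s ^ 2 + r ^ 2)) (r / √(s ^ 2 + r ^ 2)) r := by
  have hpos : 0 < s ^ 2 + r ^ 2 := by positivity
  have h2 := (((hasDerivAt_id r).pow 2).const_add (s ^ 2)).sqrt hpos.ne'
  refine h2.congr_deriv ?_
  have := Real.sqrt_pos.mpr hpos
  simp only [id]
  field_simp
  simp only [Pi.pow_apply, Nat.cast_ofNat, Nat.add_one_sub_one, pow_one]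
  exact mul_div_cancel_right₀ _ this.ne'

theorem hasDerivAt_exp_neg_mul_sqrt (κ : ℂ) {s : ℝ} (hs : s ≠ 0) (r : ℝ) :
    HasDerivAt (fun r : ℝ => Complex.exp (-κ * √(s ^ 2 + r ^ 2)))
      (-κ * (r * (Complex.exp (-κ * √(s ^ 2 + r ^ 2)) / √(s ^ 2 + r ^ 2)))) r := by
  refine (((hasDerivAt_sqrt_add_sq hs r).ofReal_comp.const_mul (-κ)).cexp).congr_deriv ?_
  push_cast
  ring

/-- The integrand is, up to the factor `-κ`, the derivative of `exp (-κ √(s² + r²))`; `s ≠ 0` keeps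
the root differentiable at `r = 0`. -/
theorem integral_mul_exp_neg_mul_sqrt {κ : ℂ} (hκ : 0 < κ.re) {s : ℝ} (hs : s ≠ 0) :
    ∫ r in Ioi (0 : ℝ), (r * (Complex.exp (-κ * √(s ^ 2 + r ^ 2)) / √(s ^ 2 + r ^ 2)) : ℂ) =
      Complex.exp (-κ * |s|) / κ := by
  have hκ0 : κ ≠ 0 := fun h => by simp [h] at hκ
  have hsqrt : Tendsto (fun r : ℝ => √(s ^ 2 + r ^ 2)) atTop atTop :=
    Real.tendsto_sqrt_atTop.comp
      (tendsto_atTop_add_const_left _ _ (tendsto_pow_atTop two_ne_zero))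
  have hlim : ∀ ν : ℂ, 0 < ν.re →
      Tendsto (fun r : ℝ => Complex.exp (-ν * √(s ^ 2 + r ^ 2))) atTop (𝓝 0) := by
    intro ν hν
    rw [tendsto_zero_iff_norm_tendsto_zero]
    have h1 : ∀ r : ℝ, ‖Complex.exp (-ν * √(s ^ 2 + r ^ 2))‖ =
        Real.exp (-(ν.re * √(s ^ 2 + r ^ 2))) := fun r => by
      rw [Complex.norm_exp]; simp
    simp_rw [h1]
    exact Real.tendsto_exp_neg_atTop_nhds_zero.comp (hsqrt.const_mul_atTop hν)
  have hint : IntegrableOn (fun r : ℝ =>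
      -κ * (r * (Complex.exp (-κ * √(s ^ 2 + r ^ 2)) / √(s ^ 2 + r ^ 2)))) (Ioi 0) := by
    refine Integrable.const_mul ?_ _
    -- The modulus of the integrand is the same expression with `κ.re` in place of `κ`: up to a
    -- constant, a nonnegative derivative of a function with a limit at infinity.
    have hreal : IntegrableOn (fun r : ℝ =>
        κ.re * (r * (Real.exp (-κ.re * √(s ^ 2 + r ^ 2)) / √(s ^ 2 + r ^ 2)))) (Ioi 0) := by
      refine integrableOn_Ioi_deriv_of_nonneg' (l := -0)
        (g := fun r => -Real.exp (-κ.re * √(s ^ 2 + r ^ 2))) ?_ ?_ ?_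
      · intro r _
        refine (((hasDerivAt_sqrt_add_sq hs r).const_mul (-κ.re)).exp.neg).congr_deriv ?_
        ring
      · intro r hr
        have hr : 0 < r := hr
        positivity
      · refine Tendsto.neg ?_
        have h1 := (Complex.continuous_re.tendsto _).comp (hlim κ.re (by simpa using hκ))
        refine h1.congr fun r => ?_
        simp only [Function.comp]
        norm_cast
    refine Integrable.mono (hreal.const_mul κ.re⁻¹) ?_ ?_
    · exact (by fun_prop : Measurable fun r : ℝ =>
        (r * (Complex.exp (-κ * √(s ^ 2 + r ^ 2)) / √(s ^ 2 + r ^ 2)) : ℂ)).aestronglyMeasurable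
    · refine Eventually.of_forall fun r => le_of_eq ?_
      rw [inv_mul_cancel_left₀ hκ.ne', norm_mul, norm_div, Complex.norm_exp, norm_mul, norm_div,
        Complex.norm_real, Complex.norm_real]
      simp
  have h := integral_Ioi_of_hasDerivAt_of_tendsto'
    (fun r _ => hasDerivAt_exp_neg_mul_sqrt κ hs r) hint (hlim κ hκ)
  rw [integral_const_mul] at h
  rw [eq_div_iff hκ0, mul_comm]
  have e : √(s ^ 2 + 0 ^ 2) = |s| := by rw [← Real.sqrt_sq_eq_abs]; simp
  rw [e] at h
  linear_combination -h

theorem integral_exp_neg_mul_abs {κ : ℂ} {ω : ℝ} (hκ : 0 < κ.re) :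
    ∫ s : ℝ, Complex.exp (-κ * |s|) * Complex.exp (-ω * s * Complex.I) =
      2 * κ / (κ ^ 2 + ω ^ 2) := by
  have hp : 0 < (κ - ω * Complex.I).re := by simpa using hκ
  have hm : (-(κ + ω * Complex.I)).re < 0 := by simpa using hκ
  have h1 : κ - ω * Complex.I ≠ 0 := fun h => by rw [h] at hp; simp at hp
  have h2 : κ + ω * Complex.I ≠ 0 := fun h => by rw [h] at hm; simp at hm
  have ep : EqOn (fun s : ℝ => Complex.exp ((κ - ω * Complex.I) * s))
      (fun s : ℝ => Complex.exp (-κ * |s|) * Complex.exp (-ω * s * Complex.I)) (Iic 0) := by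
    intro s hs
    simp only
    rw [← Complex.exp_add, abs_of_nonpos hs]
    congr 1
    push_cast
    ring
  have em : EqOn (fun s : ℝ => Complex.exp (-(κ + ω * Complex.I) * s))
      (fun s : ℝ => Complex.exp (-κ * |s|) * Complex.exp (-ω * s * Complex.I)) (Ioi 0) := by
    intro s hs
    have hs : 0 < s := hs
    simp only
    rw [← Complex.exp_add, abs_of_pos hs]
    congr 1
    ring
  rw [← intervalIntegral.integral_Iic_add_Ioi
    ((integrableOn_exp_mul_complex_Iic hp 0).congr_fun ep measurableSet_Iic)
    ((integrableOn_exp_mul_complex_Ioi hm 0).congr_fun em measurableSet_Ioi),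
    ← setIntegral_congr_fun measurableSet_Iic ep, ← setIntegral_congr_fun measurableSet_Ioi em,
    integral_exp_mul_complex_Iic hp, integral_exp_mul_complex_Ioi hm]
  have h3 : κ ^ 2 + (ω : ℂ) ^ 2 = (κ - ω * Complex.I) * (κ + ω * Complex.I) := by
    linear_combination (ω : ℂ) ^ 2 * Complex.I_sq
  rw [h3]
  simp only [Complex.ofReal_zero, mul_zero, Complex.exp_zero]
  field_simp
  ring

/-- Polar coordinates in the plane at height `s`: the Jacobian `r` makes the radial integral
elementary. -/
theorem integral_yukawa_plane {κ : ℂ} (hκ : 0 < κ.re) {s : ℝ} (hs : s ≠ 0) :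
    ∫ q : ℝ × ℝ, Complex.exp (-κ * √(s ^ 2 + (q.1 ^ 2 + q.2 ^ 2))) /
        (4 * Real.pi * √(s ^ 2 + (q.1 ^ 2 + q.2 ^ 2))) =
      Complex.exp (-κ * |s|) / (2 * κ) := by
  have hκ0 : κ ≠ 0 := fun h => by simp [h] at hκ
  rw [← integral_comp_polarCoord_symm, polarCoord_target]
  have e : ∀ p : ℝ × ℝ, p.1 • (Complex.exp (-κ * √(s ^ 2 + ((polarCoord.symm p).1 ^ 2 +
        (polarCoord.symm p).2 ^ 2))) / (4 * Real.pi * √(s ^ 2 + ((polarCoord.symm p).1 ^ 2 +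
        (polarCoord.symm p).2 ^ 2)))) =
      (p.1 * (Complex.exp (-κ * √(s ^ 2 + p.1 ^ 2)) / √(s ^ 2 + p.1 ^ 2)) : ℂ) *
        (fun _ : ℝ => (4 * Real.pi : ℂ)⁻¹) p.2 := by
    intro p
    have h1 : (polarCoord.symm p).1 ^ 2 + (polarCoord.symm p).2 ^ 2 = p.1 ^ 2 := by
      rw [polarCoord_symm_apply]
      linear_combination p.1 ^ 2 * Real.cos_sq_add_sin_sq p.2
    rw [h1, Complex.real_smul]
    simp only [div_eq_mul_inv, mul_inv]
    ring
  simp_rw [e]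
  rw [Measure.volume_eq_prod, setIntegral_prod_mul
    (fun r : ℝ => (r * (Complex.exp (-κ * √(s ^ 2 + r ^ 2)) / √(s ^ 2 + r ^ 2)) : ℂ))
    (fun _ : ℝ => (4 * Real.pi : ℂ)⁻¹),
    integral_mul_exp_neg_mul_sqrt hκ hs, setIntegral_const]
  have hpi : (Real.pi : ℂ) ≠ 0 := by exact_mod_cast Real.pi_ne_zero
  have hv : (volume : Measure ℝ).real (Ioo (-Real.pi) Real.pi) = 2 * Real.pi := by
    rw [Real.volume_real_Ioo_of_le (by linarith [Real.pi_pos])]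
    ring
  rw [hv, Complex.real_smul]
  push_cast
  field_simp
  norm_num

/-- With the first axis along `ξ`, the phase is constant on each plane orthogonal to `ξ`.
Integrating over these planes first leaves the one-dimensional Fourier transform of `exp (-κ|s|) /
(2κ)`. -/
theorem integral_exp_mul_yukawa {κ : ℂ} (hκ : 0 < κ.re) (ξ : R3) :
    ∫ x, Complex.exp (↑(-2 * Real.pi * ⟪x, ξ⟫_ℝ) * Complex.I) * yukawa κ x =
      (κ ^ 2 + (2 * Real.pi * ‖ξ‖ : ℝ) ^ 2)⁻¹ := by
  have hκ0 : κ ≠ 0 := fun h => by simp [h] at hκ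
  obtain ⟨Ψ, hΨ, hinner, hnorm⟩ := exists_coordinates_along ξ
  set ω : ℝ := 2 * Real.pi * ‖ξ‖ with hω
  set G : ℝ × (ℝ × ℝ) → ℂ := fun p => Complex.exp (-ω * p.1 * Complex.I) *
    (Complex.exp (-κ * √(p.1 ^ 2 + (p.2.1 ^ 2 + p.2.2 ^ 2))) /
        (4 * Real.pi * √(p.1 ^ 2 + (p.2.1 ^ 2 + p.2.2 ^ 2)))) with hG
  have hfun : (fun x => Complex.exp (↑(-2 * Real.pi * ⟪x, ξ⟫_ℝ) * Complex.I) * yukawa κ x) =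
      G ∘ Ψ := by
    ext x
    simp only [hG, Function.comp, yukawa, hinner x, ← hnorm x, hω]
    congr 2
    push_cast
    ring
  have hint : Integrable (G ∘ Ψ) := by
    rw [← hfun]
    refine (integrable_yukawa hκ).bdd_mul (c := 1) ?_ ?_
    · exact (by fun_prop : Measurable fun x : R3 =>
        Complex.exp (↑(-2 * Real.pi * ⟪x, ξ⟫_ℝ) * Complex.I)).aestronglyMeasurable
    · exact Eventually.of_forall fun x => by rw [Complex.norm_exp_ofReal_mul_I]
  rw [hΨ.integrable_comp_emb Ψ.measurableEmbedding] at hint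
  rw [hfun]
  have h1 : ∫ x, (G ∘ Ψ) x = ∫ p, G p := hΨ.integral_comp' G
  have hne : ∀ᵐ s : ℝ, s ≠ 0 :=
    compl_mem_ae_iff.mpr (measure_singleton (μ := (volume : Measure ℝ)) 0)
  rw [h1, Measure.volume_eq_prod, integral_prod _ hint]
  have h2 : ∀ᵐ s : ℝ, ∫ q : ℝ × ℝ, G (s, q) =
      (2 * κ)⁻¹ * (Complex.exp (-κ * |s|) * Complex.exp (-ω * s * Complex.I)) := by
    filter_upwards [hne] with s hs
    simp only [hG]
    rw [integral_const_mul, integral_yukawa_plane hκ hs]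
    ring
  rw [integral_congr_ae h2, integral_const_mul, integral_exp_neg_mul_abs hκ]
  field_simp

/-! ### The resolvent of `Δ²` on Schwartz functions -/

/-- The Fourier symbol of `Δ²`. -/
noncomputable def bilaplacianSymbol (ξ : R3) : ℝ := ((2 * Real.pi) ^ 2 * ‖ξ‖ ^ 2) ^ 2

/-- The symbol is real. Besides nonvanishing, this gives the domination needed when `z` tends to the
eigenvalue. -/
theorem abs_im_le_norm_bilaplacianSymbol_sub (z : ℂ) (ξ : R3) :
    |z.im| ≤ ‖(bilaplacianSymbol ξ : ℂ) - z‖ := by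
  refine le_trans (le_of_eq ?_) (Complex.abs_im_le_norm _)
  simp

theorem bilaplacianSymbol_sub_ne_zero {z : ℂ} (hz : z.im ≠ 0) (ξ : R3) :
    (bilaplacianSymbol ξ : ℂ) - z ≠ 0 := by
  rw [← norm_pos_iff]
  exact (abs_pos.mpr hz).trans_le (abs_im_le_norm_bilaplacianSymbol_sub z ξ)

theorem hasTemperateGrowth_bilaplacianSymbol : bilaplacianSymbol.HasTemperateGrowth := by
  unfold bilaplacianSymbol
  fun_prop

theorem hasTemperateGrowth_bilaplacianSymbol_sub (z : ℂ) :
    (fun ξ : R3 => (bilaplacianSymbol ξ : ℂ) - z).HasTemperateGrowth :=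
  (Function.Complex.hasTemperateGrowth_ofReal.comp hasTemperateGrowth_bilaplacianSymbol).sub
    (Function.HasTemperateGrowth.const z)

/-- Write `1 / (t - z) = (t - conj z) / |t - z|²` and `|t - z|² = (im z)² (1 + X²)` with `X = (t -
re z) / im z`. Then `(1 + X²)⁻¹` is a function of temperate growth composed with a polynomial in
`ξ`. -/
theorem hasTemperateGrowth_inv_bilaplacianSymbol_sub {z : ℂ} (hz : z.im ≠ 0) :
    (fun ξ : R3 => ((bilaplacianSymbol ξ : ℂ) - z)⁻¹).HasTemperateGrowth := by
  set X : R3 → ℝ := fun ξ => (z.im)⁻¹ * (bilaplacianSymbol ξ - z.re) with hX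
  have hXt : X.HasTemperateGrowth :=
    (Function.HasTemperateGrowth.const _).mul
      (hasTemperateGrowth_bilaplacianSymbol.sub (Function.HasTemperateGrowth.const _))
  have h1 := Function.Complex.hasTemperateGrowth_ofReal.comp
    ((Function.hasTemperateGrowth_one_add_norm_sq_rpow ℝ (-1)).comp hXt)
  have h2 := ((Function.HasTemperateGrowth.const ((z.im : ℂ) ^ 2)⁻¹).mul
    (hasTemperateGrowth_bilaplacianSymbol_sub (starRingEnd ℂ z))).mul h1
  convert! h2 using 1
  ext ξ
  have hne := bilaplacianSymbol_sub_ne_zero hz ξ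
  have hne' : (bilaplacianSymbol ξ : ℂ) - starRingEnd ℂ z ≠ 0 :=
    bilaplacianSymbol_sub_ne_zero (by simpa using hz) ξ
  have him : (z.im : ℂ) ≠ 0 := by exact_mod_cast hz
  have hpos : ((1 + ‖X ξ‖ ^ 2 : ℝ) : ℂ) * (z.im : ℂ) ^ 2 =
      ((bilaplacianSymbol ξ : ℂ) - z) * ((bilaplacianSymbol ξ : ℂ) - starRingEnd ℂ z) := by
    have : (1 + ‖X ξ‖ ^ 2) * z.im ^ 2 = z.im ^ 2 + (bilaplacianSymbol ξ - z.re) ^ 2 := by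
      rw [Real.norm_eq_abs, sq_abs, hX]
      field_simp
    rw [← Complex.ofReal_pow, ← Complex.ofReal_mul, this]
    apply Complex.ext
    · simp only [Complex.ofReal_re, Complex.mul_re, Complex.sub_re, Complex.sub_im,
        Complex.ofReal_im, Complex.conj_re, Complex.conj_im]
      ring
    · simp only [Complex.ofReal_re, Complex.mul_im, Complex.sub_re, Complex.sub_im,
        Complex.ofReal_im, Complex.conj_re, Complex.conj_im]
      ring
  simp only [Pi.mul_apply, Function.comp, Real.rpow_neg_one]
  rw [Complex.ofReal_inv, mul_right_comm, ← mul_inv, mul_comm ((z.im : ℂ) ^ 2), hpos]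
  field_simp

/-- A purely imaginary root would make `w` real, so one of the two roots lies in the open right
half-plane, where the Yukawa kernel decays. -/
theorem exists_sq_eq_and_re_pos {w : ℂ} (hw : w.im ≠ 0) : ∃ κ : ℂ, κ ^ 2 = w ∧ 0 < κ.re := by
  obtain ⟨κ, hκ⟩ := IsAlgClosed.exists_pow_nat_eq w two_pos
  have hre : κ.re ≠ 0 := by
    intro h
    apply hw
    rw [← hκ, pow_two, Complex.mul_im, h]
    simp
  rcases lt_or_gt_of_ne hre with h | h
  · exact ⟨-κ, by rw [neg_sq, hκ], by simpa using h⟩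
  · exact ⟨κ, hκ, h⟩

/-- The convolution kernel of `(Δ² - z)⁻¹`. -/
theorem exists_bilaplacian_resolvent_kernel {z : ℂ} (hz : z.im ≠ 0) :
    ∃ K : R3 → ℂ, Integrable K ∧ (∀ x, ‖K x‖ ≤ (√‖z‖)⁻¹ * (4 * Real.pi * ‖x‖)⁻¹) ∧
      ∀ ξ, 𝓕 K ξ = ((bilaplacianSymbol ξ : ℂ) - z)⁻¹ := by
  obtain ⟨s, hs, hsre⟩ := exists_sq_eq_and_re_pos hz
  have hsim : s.im ≠ 0 := by
    intro h
    apply hz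
    rw [← hs, pow_two, Complex.mul_im, h]
    simp
  have hs0 : s ≠ 0 := fun h => by simp [h] at hsim
  -- `κ₁` and `κ₂` belong to the factors `-Δ - s` and `-Δ + s` of `Δ² - s²`.
  obtain ⟨κ₁, h₁, h₁re⟩ := exists_sq_eq_and_re_pos (w := -s) (by simpa using hsim)
  obtain ⟨κ₂, h₂, h₂re⟩ := exists_sq_eq_and_re_pos hsim
  have hsn : √‖z‖ = ‖s‖ := by rw [← hs, norm_pow, Real.sqrt_sq (norm_nonneg s)]
  refine ⟨fun x => (2 * s)⁻¹ * (yukawa κ₁ x - yukawa κ₂ x),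
    ((integrable_yukawa h₁re).sub (integrable_yukawa h₂re)).const_mul _, fun x => ?_, fun ξ => ?_⟩
  · rw [norm_mul, norm_inv, norm_mul, hsn, Complex.norm_ofNat]
    -- The two Newtonian bounds add up to a factor `2`, which cancels the one in `(2s)⁻¹`.
    calc (2 * ‖s‖)⁻¹ * ‖yukawa κ₁ x - yukawa κ₂ x‖
        ≤ (2 * ‖s‖)⁻¹ * ((4 * Real.pi * ‖x‖)⁻¹ + (4 * Real.pi * ‖x‖)⁻¹) := by
          gcongr
          exact (norm_sub_le _ _).trans
            (add_le_add (norm_yukawa_le h₁re x) (norm_yukawa_le h₂re x))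
      _ = ‖s‖⁻¹ * (4 * Real.pi * ‖x‖)⁻¹ := by
          rw [mul_inv]
          ring
  · have hphase : ∀ κ : ℂ, 0 < κ.re → Integrable fun x : R3 =>
        Complex.exp (↑(-2 * Real.pi * ⟪x, ξ⟫_ℝ) * Complex.I) * yukawa κ x := by
      intro κ hκ
      refine (integrable_yukawa hκ).bdd_mul (c := 1) ?_ ?_
      · exact (by fun_prop : Measurable fun x : R3 =>
          Complex.exp (↑(-2 * Real.pi * ⟪x, ξ⟫_ℝ) * Complex.I)).aestronglyMeasurable
      · exact Eventually.of_forall fun x => by rw [Complex.norm_exp_ofReal_mul_I]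
    have e : ∀ x : R3, Complex.exp (↑(-2 * Real.pi * ⟪x, ξ⟫_ℝ) * Complex.I) •
        ((2 * s)⁻¹ * (yukawa κ₁ x - yukawa κ₂ x)) =
        (2 * s)⁻¹ * (Complex.exp (↑(-2 * Real.pi * ⟪x, ξ⟫_ℝ) * Complex.I) * yukawa κ₁ x -
          Complex.exp (↑(-2 * Real.pi * ⟪x, ξ⟫_ℝ) * Complex.I) * yukawa κ₂ x) := by
      intro x
      rw [smul_eq_mul]
      ring
    rw [Real.fourier_eq']
    simp_rw [e]
    rw [integral_const_mul, integral_sub (hphase κ₁ h₁re) (hphase κ₂ h₂re),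
      integral_exp_mul_yukawa h₁re, integral_exp_mul_yukawa h₂re, h₁, h₂]
    have ht : (bilaplacianSymbol ξ : ℂ) = (((2 * Real.pi * ‖ξ‖ : ℝ) : ℂ) ^ 2) ^ 2 := by
      rw [bilaplacianSymbol]
      push_cast
      ring
    have hne := bilaplacianSymbol_sub_ne_zero hz ξ
    rw [ht] at hne ⊢
    set t : ℂ := ((2 * Real.pi * ‖ξ‖ : ℝ) : ℂ) ^ 2
    have hfac : t ^ 2 - z = (-s + t) * (s + t) := by rw [← hs]; ring
    rw [hfac] at hne ⊢
    have hm := left_ne_zero_of_mul hne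
    have hp := right_ne_zero_of_mul hne
    field_simp
    ring

/-- `(Δ² - z)⁻¹` on Schwartz functions. -/
noncomputable def bilaplacianResolvent (z : ℂ) (η : 𝓢(R3, ℂ)) : 𝓢(R3, ℂ) :=
  SchwartzMap.fourierMultiplierCLM ℂ (fun ξ : R3 => ((bilaplacianSymbol ξ : ℂ) - z)⁻¹) η

theorem fourier_bilaplacianResolvent {z : ℂ} (hz : z.im ≠ 0) (η : 𝓢(R3, ℂ)) (ξ : R3) :
    𝓕 (bilaplacianResolvent z η) ξ = ((bilaplacianSymbol ξ : ℂ) - z)⁻¹ * 𝓕 η ξ := by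
  rw [bilaplacianResolvent, SchwartzMap.fourierMultiplierCLM_apply,
    FourierTransform.fourier_fourierInv_eq,
    SchwartzMap.smulLeftCLM_apply_apply (hasTemperateGrowth_inv_bilaplacianSymbol_sub hz),
    smul_eq_mul]

theorem fourier_laplacian_apply (f : 𝓢(R3, ℂ)) (ξ : R3) :
    𝓕 (Δ f) ξ = (-((2 * Real.pi) ^ 2 * ‖ξ‖ ^ 2) : ℝ) * 𝓕 f ξ := by
  rw [SchwartzMap.laplacian_eq_fourierMultiplierCLM, FourierTransform.fourier_smul,
    SchwartzMap.fourierMultiplierCLM_apply, FourierTransform.fourier_fourierInv_eq,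
    _root_.smul_apply, SchwartzMap.smulLeftCLM_apply_apply (by fun_prop), Complex.real_smul,
    Complex.real_smul]
  push_cast
  ring

theorem laplacian_laplacian_bilaplacianResolvent {z : ℂ} (hz : z.im ≠ 0) (η : 𝓢(R3, ℂ)) :
    Δ (Δ (bilaplacianResolvent z η)) = η + z • bilaplacianResolvent z η := by
  have h : 𝓕 (Δ (Δ (bilaplacianResolvent z η))) = 𝓕 (η + z • bilaplacianResolvent z η) := by
    ext ξ
    rw [FourierTransform.fourier_add, FourierTransform.fourier_smul, _root_.add_apply,
      _root_.smul_apply, fourier_laplacian_apply, fourier_laplacian_apply,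
      fourier_bilaplacianResolvent hz]
    have hne := bilaplacianSymbol_sub_ne_zero hz ξ
    have hsym : (bilaplacianSymbol ξ : ℂ) = ((-((2 * Real.pi) ^ 2 * ‖ξ‖ ^ 2) : ℝ) : ℂ) *
        ((-((2 * Real.pi) ^ 2 * ‖ξ‖ ^ 2) : ℝ) : ℂ) := by
      rw [bilaplacianSymbol]
      push_cast
      ring
    rw [← mul_assoc, ← hsym, smul_eq_mul]
    field_simp
    ring
  have hinv : ∀ f : 𝓢(R3, ℂ), 𝓕⁻ (𝓕 f) = f := fun f => FourierTransform.fourierInv_fourier_eq f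
  rw [← hinv (Δ (Δ (bilaplacianResolvent z η))), h, hinv]

theorem apply_eq_integral_fourier (f : 𝓢(R3, ℂ)) (x : R3) :
    f x = ∫ ξ, Complex.exp (↑(2 * Real.pi * ⟪ξ, x⟫_ℝ) * Complex.I) * 𝓕 f ξ := by
  have hinv : 𝓕⁻ (𝓕 f) = f := FourierTransform.fourierInv_fourier_eq f
  conv_lhs => rw [← hinv, SchwartzMap.fourierInv_coe, Real.fourierInv_eq']
  rfl

/-- The multiplication formula `∫ 𝓕K · g = ∫ K · 𝓕g`, applied to `𝓕 η` modulated so that its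
transform is `y ↦ η (x - y)`; no convolution theorem is needed. -/
theorem bilaplacianResolvent_apply {z : ℂ} (hz : z.im ≠ 0) {K : R3 → ℂ} (hK : Integrable K)
    (hFK : ∀ ξ, 𝓕 K ξ = ((bilaplacianSymbol ξ : ℂ) - z)⁻¹) (η : 𝓢(R3, ℂ)) (x : R3) :
    bilaplacianResolvent z η x = ∫ y, K y * η (x - y) := by
  set g : R3 → ℂ := fun ξ => Complex.exp (↑(2 * Real.pi * ⟪ξ, x⟫_ℝ) * Complex.I) * 𝓕 η ξ with hg
  have hgint : Integrable g := by
    refine (𝓕 η).integrable.bdd_mul (c := 1) ?_ ?_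
    · exact (by fun_prop : Measurable fun ξ : R3 =>
        Complex.exp (↑(2 * Real.pi * ⟪ξ, x⟫_ℝ) * Complex.I)).aestronglyMeasurable
    · exact Eventually.of_forall fun x => by rw [Complex.norm_exp_ofReal_mul_I]
  have hFg : ∀ y, 𝓕 g y = η (x - y) := by
    intro y
    rw [apply_eq_integral_fourier, Real.fourier_eq']
    congr 1 with ξ
    rw [hg, smul_eq_mul, ← mul_assoc, ← Complex.exp_add, inner_sub_right]
    congr 2
    push_cast
    ring
  have hself : ∫ ξ, 𝓕 K ξ * g ξ = ∫ y, K y * 𝓕 g y := by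
    simpa using! VectorFourier.integral_bilin_fourierIntegral_eq_flip (ContinuousLinearMap.mul ℂ ℂ)
      (L := innerₗ R3) Real.continuous_fourierChar continuous_inner hK hgint
  simp_rw [hFg] at hself
  rw [← hself, apply_eq_integral_fourier]
  congr 1 with ξ
  rw [fourier_bilaplacianResolvent hz, hFK, hg]
  ring

theorem enorm_bilaplacianResolvent_le {z : ℂ} (hz : z.im ≠ 0) (η : 𝓢(R3, ℂ)) (x : R3) :
    ‖bilaplacianResolvent z η x‖ₑ ≤
      ENNReal.ofReal (√‖z‖)⁻¹ * newtonPotential (fun y => ‖η y‖ₑ) x := by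
  obtain ⟨K, hK, hKle, hFK⟩ := exists_bilaplacian_resolvent_kernel hz
  rw [bilaplacianResolvent_apply hz hK hFK, ← integral_sub_left_eq_self _ volume x,
    newtonPotential, ← lintegral_const_mul' _ _ ENNReal.ofReal_ne_top]
  refine (enorm_integral_le_lintegral_enorm _).trans (lintegral_mono fun y => ?_)
  rw [sub_sub_cancel, enorm_mul, ← mul_assoc, ← ENNReal.ofReal_mul (by positivity),
    ← ofReal_norm (K (x - y))]
  gcongr
  exact hKle _

theorem integral_norm_sq_bilaplacianResolvent {z : ℂ} (hz : z.im ≠ 0) (η : 𝓢(R3, ℂ)) :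
    ∫ x, ‖bilaplacianResolvent z η x‖ ^ 2 =
      ∫ ξ, ‖((bilaplacianSymbol ξ : ℂ) - z)⁻¹‖ ^ 2 * ‖𝓕 η ξ‖ ^ 2 := by
  rw [← SchwartzMap.integral_norm_sq_fourier]
  simp_rw [fourier_bilaplacianResolvent hz, norm_mul, mul_pow]

/-! ### The eigenvalue equation tested against Schwartz functions -/

theorem ae_norm_sq_mul_norm_le_hardyNorm {V : R3 → ℂ} (hH : hardyNorm V < ∞) :
    ∀ᵐ x, ‖x‖ ^ 2 * ‖V x‖ ≤ (hardyNorm V).toReal := by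
  have h : ∀ᵐ x, ‖x‖ₑ ^ 2 * ‖V x‖ₑ ≤ hardyNorm V := ae_le_essSup
  filter_upwards [h] with x hx
  have h1 := ENNReal.toReal_mono hH.ne hx
  simpa using h1

/-- Inside the unit ball `V` is integrable and `φ` bounded; outside it `|V|` is at most the Hardy
norm and `φ` is in `L²`. -/
theorem integrable_norm_potential_mul_schwartz_sq {V : R3 → ℂ} (hV : LocallyIntegrable V volume)
    (hH : hardyNorm V < ∞) (φ : 𝓢(R3, ℂ)) :
    Integrable fun x => ‖V x‖ * ‖φ x‖ ^ 2 := by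
  set C : ℝ := ‖φ.toBoundedContinuousFunction‖ with hC
  have hφC : ∀ x, ‖φ x‖ ≤ C := fun x => φ.toBoundedContinuousFunction.norm_coe_le_norm x
  have hball : IntegrableOn V (Metric.closedBall 0 1) :=
    hV.integrableOn_isCompact (isCompact_closedBall 0 1)
  have h1 : Integrable fun x => C ^ 2 * (Metric.closedBall (0 : R3) 1).indicator
      (fun x => ‖V x‖) x :=
    ((integrable_indicator_iff measurableSet_closedBall).mpr hball.norm).const_mul _
  have h2 : Integrable fun x => (hardyNorm V).toReal * ‖φ x‖ ^ 2 :=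
    ((memLp_two_iff_integrable_sq_norm (φ.continuous.aestronglyMeasurable)).mp
      (φ.memLp 2 volume)).const_mul _
  refine (h1.add h2).mono' ?_ ?_
  · exact hV.aestronglyMeasurable.norm.mul (φ.continuous.norm.pow 2).aestronglyMeasurable
  · filter_upwards [ae_norm_sq_mul_norm_le_hardyNorm hH] with x hx
    rw [Real.norm_of_nonneg (by positivity), Pi.add_apply]
    have hA : 0 ≤ (hardyNorm V).toReal := ENNReal.toReal_nonneg
    have hsq : ‖φ x‖ ^ 2 ≤ C ^ 2 := by
      have := hφC x
      gcongr
    by_cases hxb : x ∈ Metric.closedBall (0 : R3) 1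
    · rw [indicator_of_mem hxb, mul_comm]
      have h3 : 0 ≤ (hardyNorm V).toReal * ‖φ x‖ ^ 2 := by positivity
      have h4 := mul_le_mul_of_nonneg_right hsq (norm_nonneg (V x))
      linarith
    · rw [indicator_of_notMem hxb, mul_zero, zero_add]
      have hx1 : 1 ≤ ‖x‖ ^ 2 := by
        have : 1 < ‖x‖ := by simpa using hxb
        nlinarith
      have hVA : ‖V x‖ ≤ (hardyNorm V).toReal := by
        nlinarith [norm_nonneg (V x)]
      gcongr

/-! ### Schwartz functions as test functions for the form -/

theorem toLp_mem_sobolevH2 (φ : 𝓢(R3, ℂ)) : φ.toLp 2 volume ∈ sobolevH2 := by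
  have h := SchwartzMap.memSobolev (s := 2) (p := 2) φ
  rw [← Lp.toTemperedDistribution_toLp_eq (p := 2)] at h
  exact h

theorem toLp_mem_formDomain {V : R3 → ℂ} (hV : LocallyIntegrable V volume)
    (hH : hardyNorm V < ∞) (φ : 𝓢(R3, ℂ)) : φ.toLp 2 volume ∈ formDomain V hV := by
  refine ⟨toLp_mem_sobolevH2 φ, ?_⟩
  refine (integrable_norm_potential_mul_schwartz_sq hV hH φ).congr ?_
  filter_upwards [φ.coeFn_toLp 2 volume] with x hx
  rw [hx]

theorem laplacianH2_toLp (φ : 𝓢(R3, ℂ)) :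
    laplacianH2 ⟨φ.toLp 2 volume, toLp_mem_sobolevH2 φ⟩ = (Δ φ).toLp 2 volume := by
  apply laplacianFun_unique
  rw [TemperedDistribution.laplacianCLM_apply, Lp.toTemperedDistributionCLM_apply,
    Lp.toTemperedDistributionCLM_apply, Lp.toTemperedDistribution_toLp_eq,
    Lp.toTemperedDistribution_toLp_eq, TemperedDistribution.laplacian_toTemperedDistributionCLM_eq]

/-- Complex conjugation of a Schwartz function. -/
noncomputable def schwartzConj (χ : 𝓢(R3, ℂ)) : 𝓢(R3, ℂ) :=
  SchwartzMap.postcompCLM (𝕜 := ℝ) (Complex.conjCLE : ℂ →L[ℝ] ℂ) χ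

theorem schwartzConj_apply (χ : 𝓢(R3, ℂ)) (x : R3) : schwartzConj χ x = starRingEnd ℂ (χ x) := rfl

theorem laplacian_schwartzConj (χ : 𝓢(R3, ℂ)) : Δ (schwartzConj χ) = schwartzConj (Δ χ) := by
  ext x
  rw [SchwartzMap.laplacian_apply, schwartzConj_apply, SchwartzMap.laplacian_apply]
  exact ContDiffAt.laplacian_CLM_comp_left (l := (Complex.conjCLE : ℂ →L[ℝ] ℂ))
    ((χ.smooth 2).contDiffAt)

theorem integrable_schwartz_mul (χ : 𝓢(R3, ℂ)) (ψ : L2R3) : Integrable fun x => χ x * ψ x :=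
  (χ.memLp 2 volume).integrable_mul (Lp.memLp ψ)

theorem inner_schwartzConj_toLp (χ : 𝓢(R3, ℂ)) (ψ : L2R3) :
    ⟪(schwartzConj χ).toLp 2 volume, ψ⟫_ℂ = ∫ x, χ x * ψ x := by
  rw [L2.inner_def]
  apply integral_congr_ae
  filter_upwards [(schwartzConj χ).coeFn_toLp 2 volume] with x hx
  rw [hx, RCLike.inner_apply, schwartzConj_apply, Complex.conj_conj, mul_comm]

theorem norm_schwartzConj_toLp (χ : 𝓢(R3, ℂ)) :
    ‖(schwartzConj χ).toLp 2 volume‖ = √(∫ x, ‖χ x‖ ^ 2) := by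
  rw [SchwartzMap.norm_toLp' (by norm_num) (by norm_num), Real.sqrt_eq_rpow]
  simp [schwartzConj_apply]

theorem norm_integral_schwartz_mul_le (χ : 𝓢(R3, ℂ)) (ψ : L2R3) :
    ‖∫ x, χ x * ψ x‖ ≤ √(∫ x, ‖χ x‖ ^ 2) * ‖ψ‖ := by
  rw [← inner_schwartzConj_toLp, ← norm_schwartzConj_toLp]
  exact norm_inner_le_norm _ _

theorem integral_laplacian_mul_laplacianH2 (χ : 𝓢(R3, ℂ)) (u : sobolevH2) :
    ∫ x, χ x * laplacianH2 u x = ∫ x, Δ χ x * (u : L2R3) x := by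
  have h := congrArg (fun T : 𝓢'(R3, ℂ) => T χ) (laplacianFun_spec u)
  simp only [TemperedDistribution.laplacian_apply_apply, Lp.toTemperedDistribution_apply,
    smul_eq_mul] at h
  exact h.symm

/-- Testing with a conjugate turns the sesquilinear form into a bilinear pairing, and the
distributional Laplacian of `ψ` is moved onto `χ`. -/
theorem biharmonicForm_schwartzConj {V : R3 → ℂ} (hV : LocallyIntegrable V volume)
    (hH : hardyNorm V < ∞) (χ : 𝓢(R3, ℂ)) (ψ : formDomain V hV) :
    biharmonicForm V hV ⟨(schwartzConj χ).toLp 2 volume, toLp_mem_formDomain hV hH _⟩ ψ =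
      (∫ x, Δ (Δ χ) x * (ψ : L2R3) x) + ∫ x, V x * (χ x * (ψ : L2R3) x) := by
  rw [biharmonicForm]
  congr 1
  · rw [← show ((formToH2 ψ : sobolevH2) : L2R3) = ψ from rfl,
      ← integral_laplacian_mul_laplacianH2]
    apply integral_congr_ae
    have h := laplacianH2_toLp (schwartzConj χ)
    rw [laplacian_schwartzConj] at h
    filter_upwards [(schwartzConj (Δ χ)).coeFn_toLp 2 volume] with x hx
    rw [← h] at hx
    rw [← Complex.conj_conj (Δ χ x), ← schwartzConj_apply, ← hx]
    rfl
  · apply integral_congr_ae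
    filter_upwards [(schwartzConj χ).coeFn_toLp 2 volume] with x hx
    rw [hx, schwartzConj_apply, Complex.conj_conj]

/-- The test function is the conjugate of `χ = (Δ² - z)⁻¹ η`, for which `Δ²χ = η + z χ`. -/
theorem integral_mul_eigenfunction_eq {V : R3 → ℂ} (hV : LocallyIntegrable V volume)
    (hH : hardyNorm V < ∞) {ψ : formDomain V hV} {μ : ℂ}
    (hψ : ∀ φ : formDomain V hV, biharmonicForm V hV φ ψ = ⟪(φ : L2R3), μ • (ψ : L2R3)⟫_ℂ)
    {z : ℂ} (hz : z.im ≠ 0) (η : 𝓢(R3, ℂ)) :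
    ∫ x, η x * (ψ : L2R3) x =
      (μ - z) * (∫ x, bilaplacianResolvent z η x * (ψ : L2R3) x) -
        ∫ x, V x * (bilaplacianResolvent z η x * (ψ : L2R3) x) := by
  have h := hψ ⟨(schwartzConj (bilaplacianResolvent z η)).toLp 2 volume,
    toLp_mem_formDomain hV hH _⟩
  rw [biharmonicForm_schwartzConj hV hH, inner_smul_right, inner_schwartzConj_toLp,
    laplacian_laplacian_bilaplacianResolvent hz] at h
  have h1 : ∫ x, (η + z • bilaplacianResolvent z η) x * (ψ : L2R3) x =
      (∫ x, η x * (ψ : L2R3) x) + z * ∫ x, bilaplacianResolvent z η x * (ψ : L2R3) x := by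
    rw [← integral_const_mul, ← integral_add (integrable_schwartz_mul η _)
      ((integrable_schwartz_mul _ _).const_mul z)]
    congr 1 with x
    rw [_root_.add_apply, _root_.smul_apply, smul_eq_mul]
    ring
  rw [h1] at h
  linear_combination h

/-! ### Estimates uniform in `z` and the limit at the eigenvalue -/

theorem lintegral_mul_newtonPotential_comm {f g : R3 → ℝ≥0∞} (hf : AEMeasurable f)
    (hg : AEMeasurable g) :
    ∫⁻ x, f x * newtonPotential g x = ∫⁻ y, g y * newtonPotential f y := by
  have key : ∀ {f g : R3 → ℝ≥0∞}, Measurable f → Measurable g →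
      ∫⁻ x, f x * newtonPotential g x = ∫⁻ y, g y * newtonPotential f y := by
    intro f g hf hg
    have e1 : ∀ x, f x * newtonPotential g x =
        ∫⁻ y, f x * (ENNReal.ofReal (4 * Real.pi * ‖x - y‖)⁻¹ * g y) := fun x =>
      (lintegral_const_mul _ (by fun_prop)).symm
    have e2 : ∀ y, g y * newtonPotential f y =
        ∫⁻ x, f x * (ENNReal.ofReal (4 * Real.pi * ‖x - y‖)⁻¹ * g y) := fun y => by
      rw [newtonPotential, ← lintegral_const_mul _ (by fun_prop)]
      congr 1 with x
      rw [norm_sub_rev]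
      ring
    simp_rw [e1, e2]
    exact lintegral_lintegral_swap (by
      apply Measurable.aemeasurable
      unfold Function.uncurry
      fun_prop)
  calc ∫⁻ x, f x * newtonPotential g x
      = ∫⁻ x, hf.mk f x * newtonPotential (hg.mk g) x := by
        rw [newtonPotential_congr hg.ae_eq_mk]
        apply lintegral_congr_ae
        filter_upwards [hf.ae_eq_mk] with x hx
        rw [← hx]
    _ = ∫⁻ y, hg.mk g y * newtonPotential (hf.mk f) y := key hf.measurable_mk hg.measurable_mk
    _ = ∫⁻ y, g y * newtonPotential f y := by
        rw [newtonPotential_congr hf.ae_eq_mk]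
        apply lintegral_congr_ae
        filter_upwards [hg.ae_eq_mk] with x hx
        rw [← hx]

theorem enorm_integral_potential_mul_le {f : R3 → ℂ} (hf : AEMeasurable f) {z : ℂ}
    (hz : z.im ≠ 0) (η : 𝓢(R3, ℂ)) :
    ‖∫ x, f x * bilaplacianResolvent z η x‖ₑ ≤
      ENNReal.ofReal (√‖z‖)⁻¹ * ∫⁻ y, ‖η y‖ₑ * newtonPotential (fun x => ‖f x‖ₑ) y := by
  rw [← lintegral_mul_newtonPotential_comm hf.enorm η.continuous.enorm.aemeasurable,
    ← lintegral_const_mul' _ _ ENNReal.ofReal_ne_top]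
  refine (enorm_integral_le_lintegral_enorm _).trans (lintegral_mono fun x => ?_)
  rw [enorm_mul, mul_left_comm]
  gcongr
  exact enorm_bilaplacianResolvent_le hz η x

/-- The level set is empty or a sphere centred at the origin, possibly reduced to a point. -/
theorem ae_bilaplacianSymbol_ne (μ : ℂ) : ∀ᵐ ξ : R3, (bilaplacianSymbol ξ : ℂ) ≠ μ := by
  by_cases h : ∃ ξ₀ : R3, (bilaplacianSymbol ξ₀ : ℂ) = μ
  · obtain ⟨ξ₀, h₀⟩ := h
    have hs : (volume : Measure R3) (Metric.sphere 0 ‖ξ₀‖) = 0 := Measure.addHaar_sphere _ _ _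
    filter_upwards [compl_mem_ae_iff.mpr hs] with ξ hξ heq
    apply hξ
    rw [mem_sphere_zero_iff_norm]
    rw [← h₀, Complex.ofReal_inj, bilaplacianSymbol, bilaplacianSymbol] at heq
    have hpi := Real.pi_pos
    have h1 := (sq_eq_sq₀ (by positivity) (by positivity)).mp heq
    have h2 := mul_left_cancel₀ (by positivity) h1
    exact (sq_eq_sq₀ (norm_nonneg _) (norm_nonneg _)).mp h2
  · exact Eventually.of_forall fun ξ hξ => h ⟨ξ, hξ⟩

/-- The resolvent of `Δ²` has no eigenvalue contribution: `(μ - z) (Δ² - z)⁻¹ → 0` strongly. -/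
theorem tendsto_sub_mul_integral_bilaplacianResolvent {μ : ℂ} {z : ℕ → ℂ}
    (hz : ∀ n, (z n).im ≠ 0) (hle : ∀ n, ‖μ - z n‖ ≤ |(z n).im|) (hlim : Tendsto z atTop (𝓝 μ))
    (η : 𝓢(R3, ℂ)) (ψ : L2R3) :
    Tendsto (fun n => (μ - z n) * ∫ x, bilaplacianResolvent (z n) η x * ψ x) atTop (𝓝 0) := by
  -- On the Fourier side the multiplier `(μ - z) / (symbol - z)` is bounded by `1`, by nontangential
  -- approach, and tends to `0` off the level set of `μ`; dominated convergence and Plancherel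
  -- conclude.
  have hdct : Tendsto (fun n => ∫ ξ, ‖(μ - z n) * ((bilaplacianSymbol ξ : ℂ) - z n)⁻¹‖ ^ 2 *
      ‖𝓕 η ξ‖ ^ 2) atTop (𝓝 (∫ _ : R3, (0 : ℝ))) := by
    refine tendsto_integral_of_dominated_convergence (fun ξ => ‖𝓕 η ξ‖ ^ 2) ?_ ?_ ?_ ?_
    · intro n
      have h1 : Continuous bilaplacianSymbol := by unfold bilaplacianSymbol; fun_prop
      have h2 : Continuous fun ξ : R3 => ((bilaplacianSymbol ξ : ℂ) - z n)⁻¹ :=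
        Continuous.inv₀ (by fun_prop) (bilaplacianSymbol_sub_ne_zero (hz n))
      exact (((continuous_const.mul h2).norm.pow 2).mul
        ((𝓕 η).continuous.norm.pow 2)).aestronglyMeasurable
    · exact (memLp_two_iff_integrable_sq_norm ((𝓕 η).continuous.aestronglyMeasurable)).mp
        ((𝓕 η).memLp 2 volume)
    · intro n
      refine Eventually.of_forall fun ξ => ?_
      rw [Real.norm_of_nonneg (by positivity)]
      refine mul_le_of_le_one_left (by positivity) (pow_le_one₀ (norm_nonneg _) ?_)
      rw [norm_mul, norm_inv, ← div_eq_mul_inv]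
      exact div_le_one_of_le₀ ((hle n).trans (abs_im_le_norm_bilaplacianSymbol_sub _ _))
        (norm_nonneg _)
    · filter_upwards [ae_bilaplacianSymbol_ne μ] with ξ hξ
      have h1 : Tendsto (fun n => (μ - z n) * ((bilaplacianSymbol ξ : ℂ) - z n)⁻¹) atTop
          (𝓝 ((μ - μ) * ((bilaplacianSymbol ξ : ℂ) - μ)⁻¹)) :=
        (hlim.const_sub μ).mul ((hlim.const_sub _).inv₀ (sub_ne_zero.mpr hξ))
      have h2 := (h1.norm.pow 2).mul_const (‖𝓕 η ξ‖ ^ 2)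
      simpa using h2
  have hsqrt := ((Real.continuous_sqrt.tendsto _).comp hdct).mul_const ‖ψ‖
  simp only [integral_zero, Real.sqrt_zero, zero_mul] at hsqrt
  refine squeeze_zero_norm (fun n => ?_) hsqrt
  have h1 := norm_integral_schwartz_mul_le (bilaplacianResolvent (z n) η) ψ
  rw [integral_norm_sq_bilaplacianResolvent (hz n)] at h1
  have h2 : ∫ ξ, ‖(μ - z n) * ((bilaplacianSymbol ξ : ℂ) - z n)⁻¹‖ ^ 2 * ‖𝓕 η ξ‖ ^ 2 =
      ‖μ - z n‖ ^ 2 * ∫ ξ, ‖((bilaplacianSymbol ξ : ℂ) - z n)⁻¹‖ ^ 2 * ‖𝓕 η ξ‖ ^ 2 := by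
    rw [← integral_const_mul]
    congr 1 with ξ
    rw [norm_mul]
    ring
  simp only [Function.comp]
  rw [h2, Real.sqrt_mul (by positivity), Real.sqrt_sq (norm_nonneg _), norm_mul, mul_assoc]
  gcongr

/-- Approach `μ` vertically, moving away from the real axis: `σ` is a sign compatible with that of
`im μ`, so the distance to `μ` never exceeds the distance to the axis. A real `μ` is allowed. -/
theorem exists_nonreal_approximation (μ : ℂ) : ∃ z : ℕ → ℂ, (∀ n, (z n).im ≠ 0) ∧
    (∀ n, ‖μ - z n‖ ≤ |(z n).im|) ∧ Tendsto z atTop (𝓝 μ) := by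
  obtain ⟨σ, hσ, hσμ⟩ : ∃ σ : ℝ, |σ| = 1 ∧ 0 ≤ μ.im * σ := by
    rcases le_total 0 μ.im with h | h
    · exact ⟨1, by simp, by simpa using h⟩
    · exact ⟨-1, by simp, by simpa using h⟩
  have him : ∀ δ : ℝ, 0 < δ → δ ≤ |(μ + ((σ * δ : ℝ) : ℂ) * Complex.I).im| := by
    intro δ hδ
    have hσσ : σ * σ = 1 := by rw [← abs_mul_abs_self, hσ, one_mul]
    have e : |μ.im + σ * δ| = |μ.im * σ + δ| := by
      rw [← mul_one |μ.im + σ * δ|, ← hσ, ← abs_mul]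
      congr 1
      linear_combination δ * hσσ
    rw [Complex.add_im, Complex.im_ofReal_mul, Complex.I_im, mul_one, e]
    exact (le_add_of_nonneg_left hσμ).trans (le_abs_self _)
  have hle : ∀ n : ℕ, (1 / ((n : ℝ) + 1)) ≤
      |(μ + ((σ * (1 / ((n : ℝ) + 1)) : ℝ) : ℂ) * Complex.I).im| :=
    fun n => him _ (by positivity)
  refine ⟨fun n => μ + ((σ * (1 / ((n : ℝ) + 1)) : ℝ) : ℂ) * Complex.I, fun n => ?_, fun n => ?_, ?_⟩
  · rw [← abs_pos]
    exact lt_of_lt_of_le (by positivity) (hle n)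
  · refine le_trans (le_of_eq ?_) (hle n)
    rw [sub_add_cancel_left, norm_neg, norm_mul, Complex.norm_I, Complex.norm_real, norm_mul,
      Real.norm_eq_abs, hσ, Real.norm_of_nonneg (by positivity)]
    ring
  · have h1 : Tendsto (fun n : ℕ => σ * (1 / ((n : ℝ) + 1))) atTop (𝓝 (σ * 0)) :=
      tendsto_one_div_add_atTop_nhds_zero_nat.const_mul σ
    have h2 := ((Complex.continuous_ofReal.tendsto _).comp h1).mul_const Complex.I
    have h3 := h2.const_add μ
    simpa [Function.comp_def] using h3

theorem enorm_integral_schwartz_mul_eigenfunction_le {V : R3 → ℂ}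
    (hV : LocallyIntegrable V volume) (hH : hardyNorm V < ∞) {ψ : formDomain V hV} {μ : ℂ}
    (hμ : μ ≠ 0)
    (hψ : ∀ φ : formDomain V hV, biharmonicForm V hV φ ψ = ⟪(φ : L2R3), μ • (ψ : L2R3)⟫_ℂ)
    (η : 𝓢(R3, ℂ)) :
    ‖∫ x, η x * (ψ : L2R3) x‖ₑ ≤ ENNReal.ofReal (√‖μ‖)⁻¹ *
      ∫⁻ y, ‖η y‖ₑ * newtonPotential (fun x => ‖V x * (ψ : L2R3) x‖ₑ) y := by
  obtain ⟨z, hz, hle, hlim⟩ := exists_nonreal_approximation μ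
  have hμn : 0 < √‖μ‖ := Real.sqrt_pos.mpr (norm_pos_iff.mpr hμ)
  have hVψ : AEMeasurable fun x => V x * (ψ : L2R3) x :=
    hV.aestronglyMeasurable.aemeasurable.mul (Lp.aestronglyMeasurable _).aemeasurable
  set B := ∫⁻ y, ‖η y‖ₑ * newtonPotential (fun x => ‖V x * (ψ : L2R3) x‖ₑ) y
  have h1 : Tendsto (fun n => ‖(μ - z n) * ∫ x, bilaplacianResolvent (z n) η x *
      (ψ : L2R3) x‖ₑ) atTop (𝓝 0) := by
    have := (tendsto_sub_mul_integral_bilaplacianResolvent hz hle hlim η (ψ : L2R3)).enorm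
    rwa [enorm_zero] at this
  have h2 : Tendsto (fun n => ENNReal.ofReal (√‖z n‖)⁻¹ * B) atTop
      (𝓝 (ENNReal.ofReal (√‖μ‖)⁻¹ * B)) := by
    refine ENNReal.Tendsto.mul_const (ENNReal.tendsto_ofReal
      (((Real.continuous_sqrt.tendsto _).comp hlim.norm).inv₀ hμn.ne')) (Or.inl ?_)
    rw [ne_eq, ENNReal.ofReal_eq_zero, not_le]
    positivity
  have h3 := h1.add h2
  rw [zero_add] at h3
  refine ge_of_tendsto' h3 fun n => ?_
  rw [integral_mul_eigenfunction_eq hV hH hψ (hz n)]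
  refine (enorm_sub_le).trans (add_le_add le_rfl ?_)
  have h4 := enorm_integral_potential_mul_le hVψ (hz n) η
  refine le_trans (le_of_eq ?_) h4
  congr 2 with x
  ring

/-! ### The pointwise bound on eigenfunctions and the conclusion -/

theorem locallyIntegrable_toReal_of_lintegral_closedBall {g : R3 → ℝ≥0∞} (hg : Measurable g)
    (hfin : ∀ R, ∫⁻ x in Metric.closedBall 0 R, g x ≠ ∞) :
    LocallyIntegrable fun x => (g x).toReal := by
  rw [locallyIntegrable_iff]
  intro k hk
  obtain ⟨R, hR⟩ := hk.isBounded.subset_closedBall 0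
  exact IntegrableOn.mono_set (integrable_toReal_of_lintegral_ne_top hg.aemeasurable (hfin R)) hR

/-- Take for `η` nonnegative mollifiers centred at `x`; both sides are then convolutions that
converge at almost every `x` by Lebesgue differentiation. -/
theorem ae_enorm_le_of_forall_schwartz {ψ : R3 → ℂ} (hψ : LocallyIntegrable ψ) {g : R3 → ℝ≥0∞}
    (hg : Measurable g) (hfin : ∀ R, ∫⁻ x in Metric.closedBall 0 R, g x ≠ ∞)
    (h : ∀ η : 𝓢(R3, ℂ), ‖∫ x, η x * ψ x‖ₑ ≤ ∫⁻ x, ‖η x‖ₑ * g x) :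
    ∀ᵐ x, ‖ψ x‖ₑ ≤ g x := by
  have hgl := locallyIntegrable_toReal_of_lintegral_closedBall hg hfin
  have hgae : ∀ᵐ x, g x < ∞ := by
    have h1 : ∀ n : ℕ, ∀ᵐ x, x ∈ Metric.closedBall (0 : R3) n → g x < ∞ := fun n =>
      (ae_restrict_iff' measurableSet_closedBall).mp (ae_lt_top hg (hfin n))
    filter_upwards [ae_all_iff.mpr h1] with x hx
    obtain ⟨n, hn⟩ := exists_nat_ge ‖x‖
    exact hx n (by simpa using hn)
  -- The ratio of outer to inner radius stays equal to `2`, as almost everywhere convergence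
  -- requires a bounded ratio.
  let φ : ℕ → ContDiffBump (0 : R3) := fun n =>
    { rIn := 1 / ((n : ℝ) + 1)
      rOut := 2 * (1 / ((n : ℝ) + 1))
      rIn_pos := by positivity
      rIn_lt_rOut := by
        have : (0 : ℝ) < 1 / ((n : ℝ) + 1) := by positivity
        linarith }
  have hφ : Tendsto (fun n => (φ n).rOut) atTop (𝓝 0) := by
    have := tendsto_one_div_add_atTop_nhds_zero_nat (𝕜 := ℝ).const_mul 2
    rwa [mul_zero] at this
  have hφ' : ∀ᶠ n in atTop, (φ n).rOut ≤ 2 * (φ n).rIn := Eventually.of_forall fun n => le_rfl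
  filter_upwards [ContDiffBump.ae_convolution_tendsto_right_of_locallyIntegrable hφ hφ' hψ,
    ContDiffBump.ae_convolution_tendsto_right_of_locallyIntegrable hφ hφ' hgl] with x h1 h2
  have hle : ‖ψ x‖ ≤ (g x).toReal := by
    refine le_of_tendsto_of_tendsto' h1.norm h2 fun n => ?_
    set b : R3 → ℝ := fun y => (φ n).normed volume (x - y) with hb
    have hb0 : ∀ y, 0 ≤ b y := fun y => (φ n).nonneg_normed _
    have hbs : ContDiff ℝ (⊤ : ℕ∞) b := (φ n).contDiff_normed.comp (contDiff_const.sub contDiff_id)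
    have hbc : HasCompactSupport b :=
      (φ n).hasCompactSupport_normed.comp_homeomorph (Homeomorph.subLeft x)
    have hcs : HasCompactSupport fun y => (b y : ℂ) := hbc.comp_left (g := Complex.ofReal) rfl
    have hcd : ContDiff ℝ (⊤ : ℕ∞) fun y => (b y : ℂ) := Complex.ofRealCLM.contDiff.comp hbs
    have hη := h (hcs.toSchwartzMap hcd)
    have e1 : ∀ y, hcs.toSchwartzMap hcd y = (b y : ℂ) := fun y => rfl
    simp_rw [e1] at hη
    have c1 : (convolution ((φ n).normed volume) ψ (ContinuousLinearMap.lsmul ℝ ℝ) volume) x =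
        ∫ y, (b y : ℂ) * ψ y := by
      rw [convolution_eq_swap]
      congr 1 with y
    have c2 : (convolution ((φ n).normed volume) (fun x => (g x).toReal)
        (ContinuousLinearMap.lsmul ℝ ℝ) volume) x = ∫ y, b y * (g y).toReal := by
      rw [convolution_eq_swap]
      rfl
    have hint : Integrable fun y => b y * (g y).toReal :=
      hgl.integrable_smul_left_of_hasCompactSupport hbs.continuous hbc
    have c3 : ∫⁻ y, ‖(b y : ℂ)‖ₑ * g y = ENNReal.ofReal (∫ y, b y * (g y).toReal) := by
      rw [ofReal_integral_eq_lintegral_ofReal hint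
        (Eventually.of_forall fun y => mul_nonneg (hb0 y) ENNReal.toReal_nonneg)]
      apply lintegral_congr_ae
      filter_upwards [hgae] with y hy
      rw [ENNReal.ofReal_mul (hb0 y), ENNReal.ofReal_toReal hy.ne, ← ofReal_norm,
        Complex.norm_real, Real.norm_of_nonneg (hb0 y)]
    rw [c1, c2]
    rw [c3, ← ofReal_norm] at hη
    exact (ENNReal.ofReal_le_ofReal_iff (integral_nonneg fun y =>
      mul_nonneg (hb0 y) ENNReal.toReal_nonneg)).mp hη
  rw [← ofReal_norm]
  exact (ENNReal.ofReal_le_ofReal hle).trans ENNReal.ofReal_toReal_le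

theorem ae_sqrt_norm_le_hardyNorm {V : R3 → ℂ} (hH : hardyNorm V < ∞) :
    ∀ᵐ x, ENNReal.ofReal √‖V x‖ ≤
      ENNReal.ofReal √(hardyNorm V).toReal * ENNReal.ofReal ‖x‖⁻¹ := by
  filter_upwards [ae_norm_sq_mul_norm_le_hardyNorm hH,
    compl_mem_ae_iff.mpr (measure_singleton (μ := (volume : Measure R3)) 0)] with x hx hx0
  have hx0 : 0 < ‖x‖ := norm_pos_iff.mpr hx0
  rw [← ENNReal.ofReal_mul (Real.sqrt_nonneg _)]
  apply ENNReal.ofReal_le_ofReal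
  rw [← div_eq_mul_inv, le_div_iff₀ hx0, ← Real.sqrt_sq hx0.le, ← Real.sqrt_mul (norm_nonneg _)]
  apply Real.sqrt_le_sqrt
  rwa [mul_comm]

theorem enorm_mul_eq_sqrt_mul (v w : ℂ) :
    ‖v * w‖ₑ = ENNReal.ofReal √‖v‖ * (ENNReal.ofReal √‖v‖ * ‖w‖ₑ) := by
  rw [enorm_mul, ← mul_assoc, ← ENNReal.ofReal_mul (Real.sqrt_nonneg _),
    Real.mul_self_sqrt (norm_nonneg _), ofReal_norm]

/-- The essential step: `|V|^{1/2} ψ` is dominated by `|μ|^{-1/2} ‖V‖_H |x|⁻¹ (-Δ)⁻¹ |x|⁻¹`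
applied to itself. -/
theorem eigenfunction_eq_zero_of_lt {V : R3 → ℂ} (hV : LocallyIntegrable V volume)
    (hH : hardyNorm V < ∞) {ψ : formDomain V hV} {μ : ℂ}
    (hψ : ∀ φ : formDomain V hV, biharmonicForm V hV φ ψ = ⟪(φ : L2R3), μ • (ψ : L2R3)⟫_ℂ)
    (hlt : 16 * (hardyNorm V).toReal ^ 2 < ‖μ‖) : (ψ : L2R3) = 0 := by
  set A : ℝ := (hardyNorm V).toReal with hA
  have hA0 : 0 ≤ A := ENNReal.toReal_nonneg
  have hμ : 0 < ‖μ‖ := lt_of_le_of_lt (by positivity) hlt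
  have hμ0 : μ ≠ 0 := norm_pos_iff.mp hμ
  set w : R3 → ℂ := ((ψ : L2R3) : R3 → ℂ) with hw
  have hwm : AEMeasurable w := (Lp.aestronglyMeasurable _).aemeasurable
  have hVm : AEMeasurable V := hV.aestronglyMeasurable.aemeasurable
  have hum : AEMeasurable fun x => ENNReal.ofReal √‖V x‖ * ‖w x‖ₑ :=
    (ENNReal.measurable_ofReal.comp_aemeasurable
      (Real.continuous_sqrt.measurable.comp_aemeasurable hVm.norm)).mul hwm.enorm
  obtain ⟨u, hu, hueq⟩ := hum
  set U : ℝ≥0∞ := ∫⁻ x, u x ^ 2 with hU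
  -- Finiteness comes from the form domain; without it the final absorption `U ≤ q U`, `q < 1`,
  -- would prove nothing.
  have hUfin : U ≠ ∞ := by
    have h1 : U = ∫⁻ x, ENNReal.ofReal (‖V x‖ * ‖w x‖ ^ 2) := by
      apply lintegral_congr_ae
      filter_upwards [hueq] with x hx
      rw [← hx, mul_pow, ← ENNReal.ofReal_pow (Real.sqrt_nonneg _), Real.sq_sqrt (norm_nonneg _),
        ENNReal.ofReal_mul (norm_nonneg _), ENNReal.ofReal_pow (norm_nonneg _), ofReal_norm (w x)]
    rw [h1, ← ofReal_integral_eq_lintegral_ofReal ψ.2.2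
      (Eventually.of_forall fun x => by positivity)]
    exact ENNReal.ofReal_ne_top
  have hf : (fun x => ‖V x * w x‖ₑ) ≤ᵐ[volume]
      fun x => ENNReal.ofReal √A * (ENNReal.ofReal ‖x‖⁻¹ * u x) := by
    filter_upwards [hueq, ae_sqrt_norm_le_hardyNorm hH] with x hx hx'
    rw [enorm_mul_eq_sqrt_mul, hx, ← mul_assoc]
    gcongr
  set P : R3 → ℝ≥0∞ := newtonPotential fun y => ENNReal.ofReal ‖y‖⁻¹ * u y with hP
  have hPm : Measurable P := measurable_newtonPotential (by fun_prop)
  have hTU : ∫⁻ x, (ENNReal.ofReal ‖x‖⁻¹ * P x) ^ 2 ≤ 16 * U :=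
    lintegral_weighted_newtonPotential_sq_le hu
  have hG : ∀ x, newtonPotential (fun x => ‖V x * w x‖ₑ) x ≤ ENNReal.ofReal √A * P x := by
    intro x
    rw [hP, ← newtonPotential_const_mul ENNReal.ofReal_ne_top]
    exact newtonPotential_mono hf x
  set c : ℝ≥0∞ := ENNReal.ofReal (√‖μ‖)⁻¹ with hc
  have hne : ∀ᵐ x : R3, x ≠ 0 :=
    compl_mem_ae_iff.mpr (measure_singleton (μ := (volume : Measure R3)) 0)
  -- Only the weighted potential `|x|⁻¹ P` is known to be in `L²`; on a ball `|x| ≤ R`, and `t ≤ 1 +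
  -- t²` turns this into local integrability of `P`.
  have hPfin : ∀ R, ∫⁻ x in Metric.closedBall 0 R, P x ≠ ∞ := by
    intro R
    have h1 : ∀ᵐ x ∂(volume.restrict (Metric.closedBall (0 : R3) R)), P x ≤
        ENNReal.ofReal R * (1 + (ENNReal.ofReal ‖x‖⁻¹ * P x) ^ 2) := by
      filter_upwards [ae_restrict_of_ae hne, ae_restrict_mem measurableSet_closedBall] with x hx hxR
      have hx0 : 0 < ‖x‖ := norm_pos_iff.mpr hx
      have hxR : ‖x‖ ≤ R := by simpa using hxR
      have e : P x = ENNReal.ofReal ‖x‖ * (ENNReal.ofReal ‖x‖⁻¹ * P x) := by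
        rw [← mul_assoc, ← ENNReal.ofReal_mul hx0.le, mul_inv_cancel₀ hx0.ne', ENNReal.ofReal_one,
          one_mul]
      have h2 : ∀ t : ℝ≥0∞, t ≤ 1 + t ^ 2 := by
        intro t
        rcases le_total t 1 with ht | ht
        · exact ht.trans le_self_add
        · exact (le_self_pow₀ ht two_ne_zero).trans le_add_self
      nth_rw 1 [e]
      exact mul_le_mul' (ENNReal.ofReal_le_ofReal hxR) (h2 _)
    refine ne_top_of_le_ne_top ?_ (lintegral_mono_ae h1)
    rw [lintegral_const_mul' _ _ ENNReal.ofReal_ne_top, lintegral_add_left measurable_const]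
    refine ENNReal.mul_ne_top ENNReal.ofReal_ne_top (ENNReal.add_ne_top.mpr ⟨?_, ?_⟩)
    · rw [lintegral_one, Measure.restrict_apply_univ]
      exact measure_closedBall_lt_top.ne
    · exact ne_top_of_le_ne_top (ENNReal.mul_ne_top (by norm_num) hUfin)
        ((setLIntegral_le_lintegral _ _).trans hTU)
  have hbound : ∀ᵐ x, ‖w x‖ₑ ≤ c * (ENNReal.ofReal √A * P x) := by
    refine ae_enorm_le_of_forall_schwartz
      ((Lp.memLp (ψ : L2R3)).locallyIntegrable (by norm_num)) (by fun_prop) ?_ ?_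
    · intro R
      rw [lintegral_const_mul' _ _ ENNReal.ofReal_ne_top,
        lintegral_const_mul' _ _ ENNReal.ofReal_ne_top]
      exact ENNReal.mul_ne_top ENNReal.ofReal_ne_top
        (ENNReal.mul_ne_top ENNReal.ofReal_ne_top (hPfin R))
    · intro η
      refine (enorm_integral_schwartz_mul_eigenfunction_le hV hH hμ0 hψ η).trans ?_
      rw [← lintegral_const_mul' _ _ ENNReal.ofReal_ne_top]
      refine lintegral_mono fun x => ?_
      rw [mul_left_comm]
      gcongr
      exact hG x
  -- Multiplying the pointwise bound on `ψ` by `|V|^(1/2)` supplies the second factor `√A / |x|`.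
  have hub : ∀ᵐ x, u x ≤ c * ENNReal.ofReal A * (ENNReal.ofReal ‖x‖⁻¹ * P x) := by
    filter_upwards [hueq, hbound, ae_sqrt_norm_le_hardyNorm hH] with x hx h1 h2
    rw [← hx]
    refine (mul_le_mul' h2 h1).trans (le_of_eq ?_)
    rw [← hA, ← Real.mul_self_sqrt hA0, ENNReal.ofReal_mul (Real.sqrt_nonneg _),
      Real.mul_self_sqrt hA0]
    ring
  have hUle : U ≤ ENNReal.ofReal (16 * A ^ 2 / ‖μ‖) * U := by
    calc U ≤ ∫⁻ x, (c * ENNReal.ofReal A) ^ 2 * (ENNReal.ofReal ‖x‖⁻¹ * P x) ^ 2 := by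
          apply lintegral_mono_ae
          filter_upwards [hub] with x hx
          rw [← mul_pow]
          exact pow_le_pow_left' hx 2
      _ ≤ (c * ENNReal.ofReal A) ^ 2 * (16 * U) := by
          rw [lintegral_const_mul' _ _ (by rw [hc]; finiteness)]
          gcongr
      _ = ENNReal.ofReal (16 * A ^ 2 / ‖μ‖) * U := by
          rw [← mul_assoc, hc, ← ENNReal.ofReal_mul (by positivity),
            ← ENNReal.ofReal_pow (by positivity), show (16 : ℝ≥0∞) = ENNReal.ofReal 16 by norm_num,
            ← ENNReal.ofReal_mul (by positivity), mul_pow, inv_pow, Real.sq_sqrt hμ.le]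
          congr 2
          field_simp
  have hU0 : U = 0 := by
    by_contra hne0
    have h1 : ENNReal.ofReal (16 * A ^ 2 / ‖μ‖) < 1 := by
      rw [ENNReal.ofReal_lt_one]
      exact (div_lt_one hμ).mpr hlt
    have h2 := ENNReal.mul_lt_mul_left hne0 hUfin h1
    rw [one_mul] at h2
    exact absurd hUle (not_le.mpr h2)
  have hu0 : u =ᵐ[volume] 0 := by
    have h1 := (lintegral_eq_zero_iff (hu.pow_const 2)).mp hU0
    filter_upwards [h1] with x hx
    simpa using hx
  -- Vanishing of `u` says nothing about `ψ` where `V = 0`; there the pointwise bound by the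
  -- potential `P` is used once more.
  have hP0 : ∀ x, P x = 0 := by
    intro x
    rw [hP, newtonPotential_congr (h' := fun _ => 0) (by
      filter_upwards [hu0] with y hy
      rw [hy, Pi.zero_apply, mul_zero])]
    simp [newtonPotential]
  rw [Lp.eq_zero_iff_ae_eq_zero]
  filter_upwards [hbound] with x hx
  rw [hP0, mul_zero, mul_zero] at hx
  simpa using hx

theorem mainTheorem5 (V : R3 → ℂ) (hV : LocallyIntegrable V volume) (hH : hardyNorm V < ∞) :
    pointSpectrum (biharmonicOperator V hV) ⊆
      {μ : ℂ | ‖μ‖ ≤ 16 * (hardyNorm V).toReal ^ 2} := by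
  rintro μ ⟨ψ, hne, heq⟩
  have hgraph := (biharmonicOperator V hV).mem_graph ψ
  rw [biharmonicOperator_graph, heq] at hgraph
  obtain ⟨ψ', hψ', h⟩ := hgraph
  simp only at hψ' h
  rw [← hψ'] at h hne
  by_contra hlt
  exact hne (eigenfunction_eq_zero_of_lt hV hH h (not_le.mp hlt))
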